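/- Let $1\le N\le 4$, let $\Omega\subset\mathbb{R}^N$ be a bounded open set (for instance a bounded domain with Lipschitz boundary), let $m\in\mathbb{N}$ and $\varepsilon_1,\dots,\varepsilon_m>0$. Let $H=H_0^1(\Omega,\mathbb{R}^m)$, with $\|\mathbf u\|_H=\big(\int_\Omega\sum_{i=1}^m\varepsilon_i|\nabla u_i|^2\,dx\big)^{1/2}$. Let $\lambda_1$ be the first Dirichlet eigenvalue of $-\Delta$ in $\Omega$. Let $\mathbf g=(g_{ij})\in\mathbb{R}^{m\times m}$ be a symmetric matrix such that either $g_{ij}>0$ for all $i,j$, or $\mathbf g$ is positive definite. Let $a_1,\dots,a_m\in L^\infty(\Omega)$ satisfy $a_i(x)>-\varepsilon_i\lambda_1$ for a.e. $x\in\Omega$ and all $i$. For $\mathbf u\in H$ put $$K(\mathbf u)=\int_\Omega\sum_{i=1}^m\big(\varepsilon_i|\nabla u_i|^2+a_iu_i^2\big)dx,\qquad I(\mathbf u)=\int_\Omega\sum_{i,j=1}^m g_{ij}u_i^2u_j^2\,dx,\qquad E(\mathbf u)=\tfrac12K(\mathbf u)-\tfrac14I(\mathbf u).$$ Then $E\in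 C^2(H,\mathbb{R})$. Let $\mathcal N=\{\mathbf u\in H\setminus\{0\}:\langle E'(\mathbf u),\mathbf u\rangle=0\}$, where $E'$ and $E''$ are Fréchet derivatives. The following hold. (i) For every $\mathbf v\in H\setminus\{0\}$, the function $s\mapsto E(s\mathbf v)$ has a unique critical point $s_{\mathbf v}$ in $(0,\infty)$, and $s_{\mathbf v}\mathbf v\in\mathcal N$. Moreover $$s_{\mathbf v}=\Big(\frac{K(\mathbf v)}{I(\mathbf v)}\Big)^{1/2}=\left(\frac{\sum_{i=1}^m\int_\Omega(\varepsilon_i|\nabla v_i|^2+a_iv_i^2)\,dx}{\sum_{i,j=1}^m\int_\Omega g_{ij}v_i^2v_j^2\,dx}\right)^{1/2}.$$ (ii) $\langle E''(\mathbf u)\mathbf u,\mathbf u\rangle<0$ for all $\mathbf u\in\mathcal N$. (iii) There is a constant $\sigma_0>0$ such that $\|\mathbf u\|_H\ge\sigma_0$ for all $\mathbf u\in\mathcal N$. -/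

import Mathlib

open MeasureTheory
open scoped ContDiff Gradient

noncomputable section

namespace NehariSystem

/-- `ℝ^N` with its Euclidean norm. -/
abbrev Space (N : ℕ) : Type := EuclideanSpace ℝ (Fin N)

/-- Lebesgue measure on `Ω`. -/
abbrev vol {N : ℕ} (Ω : Set (Space N)) : Measure (Space N) := volume.restrict Ω

/-- The Hilbert space `L²(Ω) × L²(Ω; ℝ^N)`, with norm `(‖f‖² + ‖F‖²)^{1/2}`. -/
abbrev L2Pair {N : ℕ} (Ω : Set (Space N)) : Type :=
  WithLp 2 (Lp ℝ 2 (vol Ω) × Lp (Space N) 2 (vol Ω))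

/-- `φ ∈ C_c^∞(Ω)`. -/
structure IsTestFunction {N : ℕ} (Ω : Set (Space N)) (φ : Space N → ℝ) : Prop where
  smooth : ContDiff ℝ ∞ φ
  compact : HasCompactSupport φ
  support : tsupport φ ⊆ Ω

/-- The set of the pairs `(φ, ∇φ)` with `φ ∈ C_c^∞(Ω)`, as a subspace of `L²(Ω) × L²(Ω; ℝ^N)`. -/
def testPairs {N : ℕ} (Ω : Set (Space N)) : Submodule ℝ (L2Pair Ω) where
  carrier := {p | ∃ φ : Space N → ℝ, IsTestFunction Ω φ ∧
    p.fst =ᵐ[vol Ω] φ ∧ p.snd =ᵐ[vol Ω] ∇ φ}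
  zero_mem' := by
    refine ⟨fun _ => 0, ⟨contDiff_const, HasCompactSupport.zero, by simp [tsupport]⟩, ?_, ?_⟩
    · exact Lp.coeFn_zero _ _ _
    · refine (Lp.coeFn_zero _ _ _).trans (Filter.Eventually.of_forall fun x => ?_)
      simp [gradient]
  add_mem' := by
    rintro p q ⟨φ, hφ, h1, h2⟩ ⟨ψ, hψ, h3, h4⟩
    refine ⟨fun x => φ x + ψ x, ⟨hφ.smooth.add hψ.smooth, hφ.compact.add hψ.compact,
      (tsupport_add φ ψ).trans (Set.union_subset hφ.support hψ.support)⟩, ?_, ?_⟩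
    · filter_upwards [Lp.coeFn_add p.fst q.fst, h1, h3] with x hx hx1 hx3
      rw [← hx1, ← hx3]
      exact hx
    · filter_upwards [Lp.coeFn_add p.snd q.snd, h2, h4] with x hx hx2 hx4
      have d1 : DifferentiableAt ℝ φ x := (hφ.smooth.differentiable (by simp)) x
      have d2 : DifferentiableAt ℝ ψ x := (hψ.smooth.differentiable (by simp)) x
      have : ∇ (fun x => φ x + ψ x) x = ∇ φ x + ∇ ψ x := by
        simp [gradient, fderiv_fun_add d1 d2]
      rw [this, ← hx2, ← hx4]
      exact hx
  smul_mem' := by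
    rintro c p ⟨φ, hφ, h1, h2⟩
    refine ⟨fun x => c • φ x, ⟨hφ.smooth.const_smul c, hφ.compact.smul_left (f := fun _ => c),
      (closure_mono (Function.support_const_smul_subset c φ)).trans hφ.support⟩, ?_, ?_⟩
    · filter_upwards [Lp.coeFn_smul c p.fst, h1] with x hx hx1
      rw [← hx1]
      exact hx
    · filter_upwards [Lp.coeFn_smul c p.snd, h2] with x hx hx2
      have d1 : DifferentiableAt ℝ φ x := (hφ.smooth.differentiable (by simp)) x
      have : ∇ (fun x => c • φ x) x = c • ∇ φ x := by
        simp only [gradient, fderiv_fun_const_smul d1 c]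
        simp
      rw [this, ← hx2]
      exact hx

/-- The Sobolev space `H_0^1(Ω)`: the closure of `C_c^∞(Ω)` in the `H^1` norm
`(‖u‖²_{L²} + ‖∇u‖²_{L²})^{1/2}`. A function `u ∈ H_0^1(Ω)` is represented by the pair `(u, ∇u)` of
itself and its weak gradient: if `φ_n → u` and `∇φ_n → F` in `L²` with `φ_n ∈ C_c^∞(Ω)`, then
`F` is the weak gradient of `u`, so it is determined by `u`. -/
abbrev H01 {N : ℕ} (Ω : Set (Space N)) : Submodule ℝ (L2Pair Ω) :=
  (testPairs Ω).topologicalClosure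

/-- The function `u` (up to null sets) underlying an element of `H_0^1(Ω)`. -/
def fn {N : ℕ} {Ω : Set (Space N)} (u : H01 Ω) : Space N → ℝ := (u : L2Pair Ω).fst

/-- The weak gradient `∇u` of `u ∈ H_0^1(Ω)`. -/
def grad {N : ℕ} {Ω : Set (Space N)} (u : H01 Ω) : Space N → Space N := (u : L2Pair Ω).snd

/-- `μ` is an eigenvalue of the Dirichlet Laplacian `-Δ` in `Ω` (weak formulation). -/
def IsDirichletEigenvalue {N : ℕ} (Ω : Set (Space N)) (μ : ℝ) : Prop :=
  ∃ φ : H01 Ω, φ ≠ 0 ∧ ∀ ψ : H01 Ω,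
    ∫ x in Ω, inner ℝ (grad φ x) (grad ψ x) = μ * ∫ x in Ω, fn φ x * fn ψ x

/-- The first Dirichlet eigenvalue `λ₁` of `-Δ` in `Ω`. -/
def firstEigenvalue {N : ℕ} (Ω : Set (Space N)) : ℝ := sInf {μ | IsDirichletEigenvalue Ω μ}

/-- `H = H_0^1(Ω, ℝ^m)`, with its `H^1` norm. (The weighted norm `hNorm` below is equivalent to it
on a bounded `Ω`, so that both give the same Fréchet derivatives.) -/
abbrev H {N : ℕ} (Ω : Set (Space N)) (m : ℕ) : Type := PiLp 2 (fun _ : Fin m => H01 Ω)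

variable {N m : ℕ} {Ω : Set (Space N)}

/-- The norm `‖u‖_H = (∫_Ω ∑ᵢ εᵢ |∇uᵢ|²)^{1/2}`. -/
def hNorm (ε : Fin m → ℝ) (u : H Ω m) : ℝ :=
  Real.sqrt (∫ x in Ω, ∑ i, ε i * ‖grad (u i) x‖ ^ 2)

/-- `K(u) = ∫_Ω ∑ᵢ (εᵢ |∇uᵢ|² + aᵢ uᵢ²)`. -/
def K (ε : Fin m → ℝ) (a : Fin m → Space N → ℝ) (u : H Ω m) : ℝ :=
  ∫ x in Ω, ∑ i, (ε i * ‖grad (u i) x‖ ^ 2 + a i x * fn (u i) x ^ 2)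

/-- `I(u) = ∫_Ω ∑ᵢⱼ gᵢⱼ uᵢ² uⱼ²`. -/
def I (g : Matrix (Fin m) (Fin m) ℝ) (u : H Ω m) : ℝ :=
  ∫ x in Ω, ∑ i, ∑ j, g i j * fn (u i) x ^ 2 * fn (u j) x ^ 2

/-- The energy `E(u) = K(u)/2 - I(u)/4`. -/
def E (ε : Fin m → ℝ) (a : Fin m → Space N → ℝ) (g : Matrix (Fin m) (Fin m) ℝ) (u : H Ω m) : ℝ :=
  1 / 2 * K ε a u - 1 / 4 * I g u

/-- The Nehari manifold `{u ∈ H \ {0} : ⟨E'(u), u⟩ = 0}`. -/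
def nehari (Ω : Set (Space N)) (ε : Fin m → ℝ) (a : Fin m → Space N → ℝ)
    (g : Matrix (Fin m) (Fin m) ℝ) : Set (H Ω m) :=
  {u | u ≠ 0 ∧ fderiv ℝ (E ε a g) u u = 0}

end NehariSystem

end

/-!
Scaling gives `E (s v) = s² K(v) / 2 - s⁴ I(v) / 4`. If `K(v)` and `I(v)` are positive, this
function of `s > 0` has the single critical point `(K(v) / I(v))^{1/2}`; on the Nehari manifold,
which is `K = I` away from `0`, its second derivative at `s = 1` is `K - 3 I = -2 K < 0`; and
`K ≥ c ‖u‖²` together with `I ≤ D ‖u‖⁴` keeps the Nehari manifold away from `0`.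

`I` is positive because `g` is strictly copositive, and it is a bounded quartic form because
`H_0^1(Ω) ⊆ L⁴(Ω)` for `N ≤ 4`. For `u ≠ 0`, the variational characterization of `λ₁` gives
`ε ∫ |∇u|² + ∫ a u² ≥ ∫ (a + ε λ₁) u² > 0`, and compactness of `H_0^1(Ω) → L²(Ω)` upgrades this
positivity of `K` to coercivity. The compactness comes from averaging over small balls.
-/

noncomputable section

namespace NehariSystem

open Filter Topology
open scoped ENNReal NNReal

/-! ### Coercive forms and compact operators -/

section Forms

variable {V W : Type*} [NormedAddCommGroup V] [NormedSpace ℝ V]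

theorem cauchySeq_of_garding [NormedAddCommGroup W] [NormedSpace ℝ W] {B : V →L[ℝ] V →L[ℝ] ℝ}
    {J : V →L[ℝ] W} (hB : ∀ v, 0 ≤ B v v) {c C : ℝ} (hc : 0 < c)
    (hcC : ∀ v, c * ‖v‖ ^ 2 ≤ B v v + C * ‖J v‖ ^ 2) {v : ℕ → V}
    (hBv : Tendsto (fun n => B (v n) (v n)) atTop (𝓝 0)) (hJv : CauchySeq fun n => J (v n)) :
    CauchySeq v := by
  have parallelogram (x y : V) : B (x - y) (x - y) ≤ 2 * B x x + 2 * B y y := by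
    have h := hB (x + y)
    simp only [map_add, map_sub, add_apply, sub_apply] at h ⊢
    linarith
  rw [cauchySeq_iff_tendsto_dist_atTop_0, ← prod_atTop_atTop_eq] at hJv ⊢
  have hlim : Tendsto (fun p : ℕ × ℕ => √((2 * B (v p.1) (v p.1) + 2 * B (v p.2) (v p.2) +
      C * dist (J (v p.1)) (J (v p.2)) ^ 2) / c)) (atTop ×ˢ atTop) (𝓝 0) := by
    simpa using (((((hBv.comp tendsto_fst).const_mul 2).add
      ((hBv.comp tendsto_snd).const_mul 2)).add ((hJv.pow 2).const_mul C)).div_const c).sqrt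
  refine squeeze_zero (fun _ => dist_nonneg) (fun p => Real.le_sqrt_of_sq_le ?_) hlim
  rw [le_div_iff₀ hc, dist_eq_norm, dist_eq_norm, ← map_sub, mul_comm]
  exact (hcC _).trans (by gcongr; exact parallelogram _ _)

theorem exists_unit_seq_tendsto_zero_of_not_isCoercive {B : V →L[ℝ] V →L[ℝ] ℝ}
    (hB : ∀ v, 0 ≤ B v v) (h : ¬ IsCoercive B) :
    ∃ v : ℕ → V, (∀ n, ‖v n‖ = 1) ∧ Tendsto (fun n => B (v n) (v n)) atTop (𝓝 0) := by
  have hunit (n : ℕ) : ∃ v : V, ‖v‖ = 1 ∧ B v v ≤ 1 / ((n : ℝ) + 1) := by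
    simp only [IsCoercive, not_exists, not_and, not_forall, not_le] at h
    obtain ⟨v, hv⟩ := h (1 / ((n : ℝ) + 1)) (by positivity)
    have hv0 : 0 < ‖v‖ := norm_pos_iff.2 (by rintro rfl; simp at hv)
    refine ⟨‖v‖⁻¹ • v, by simp [norm_smul, hv0.ne'], ?_⟩
    calc B (‖v‖⁻¹ • v) (‖v‖⁻¹ • v) = B v v / (‖v‖ * ‖v‖) := by
          simp only [map_smul, smul_apply, smul_eq_mul]; field_simp
      _ ≤ 1 / ((n : ℝ) + 1) := by rw [div_le_iff₀ (by positivity), ← mul_assoc]; exact hv.le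
  choose v hv1 hvB using hunit
  exact ⟨v, hv1, squeeze_zero (fun n => hB _) hvB tendsto_one_div_add_atTop_nhds_zero_nat⟩

theorem isCoercive_of_isCompactOperator [CompleteSpace V] [NormedAddCommGroup W] [NormedSpace ℝ W]
    {B : V →L[ℝ] V →L[ℝ] ℝ} {J : V →L[ℝ] W} (hJ : IsCompactOperator J)
    (hB : ∀ v, v ≠ 0 → 0 < B v v) {c C : ℝ} (hc : 0 < c)
    (hcC : ∀ v, c * ‖v‖ ^ 2 ≤ B v v + C * ‖J v‖ ^ 2) : IsCoercive B := by
  have hB0 (v : V) : 0 ≤ B v v := by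
    obtain rfl | hv := eq_or_ne v 0
    · simp
    · exact (hB v hv).le
  by_contra hcon
  obtain ⟨v, hv1, hvB⟩ := exists_unit_seq_tendsto_zero_of_not_isCoercive hB0 hcon
  obtain ⟨K, hK, hJK⟩ := IsCompactOperator.image_closedBall_subset_compact
    (f := (J : V →ₗ[ℝ] W)) hJ 1
  obtain ⟨w, -, θ, hθ, hw⟩ := hK.tendsto_subseq (x := fun n => J (v n)) fun n =>
    hJK ⟨v n, by simp [hv1], rfl⟩
  have hθB := hvB.comp hθ.tendsto_atTop
  obtain ⟨u, hu⟩ := cauchySeq_tendsto_of_complete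
    (cauchySeq_of_garding hB0 hc hcC (v := v ∘ θ) hθB hw.cauchySeq)
  have hu1 : ‖u‖ = 1 := tendsto_nhds_unique hu.norm (by simp [hv1])
  have huB : B u u = 0 :=
    tendsto_nhds_unique (((by fun_prop : Continuous fun v => B v v).tendsto u).comp hu) hθB
  exact (hB u (norm_ne_zero_iff.1 (by simp [hu1]))).ne' huB

/-- The pullback `(v, w) ↦ ⟪T v, T w⟫` of the inner product under `T`. -/
def pullbackInner [NormedAddCommGroup W] [InnerProductSpace ℝ W] (T : V →L[ℝ] W) :
    V →L[ℝ] V →L[ℝ] ℝ :=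
  (innerSL ℝ).bilinearComp T T

theorem pullbackInner_apply_self [NormedAddCommGroup W] [InnerProductSpace ℝ W] (T : V →L[ℝ] W)
    (v : V) : pullbackInner T v v = ‖T v‖ ^ 2 :=
  real_inner_self_eq_norm_sq _

theorem exists_lt_forall_mul_norm_sq_le [CompleteSpace V] [NormedAddCommGroup W]
    [InnerProductSpace ℝ W] {A : V →L[ℝ] V →L[ℝ] ℝ} (hA : IsCoercive A) {J : V →L[ℝ] W}
    (hJ : IsCompactOperator J) {t : ℝ} (ht : ∀ v, v ≠ 0 → t * ‖J v‖ ^ 2 < A v v) :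
    ∃ t', t < t' ∧ ∀ v, t' * ‖J v‖ ^ 2 ≤ A v v := by
  obtain ⟨c, hc, hcA⟩ := hA
  have hB (v : V) : (A - t • pullbackInner J) v v = A v v - t * ‖J v‖ ^ 2 := by
    simp [pullbackInner_apply_self]
  obtain ⟨c', hc', hcB⟩ := isCoercive_of_isCompactOperator
    (B := A - t • pullbackInner J) (C := t) hJ
    (fun v hv => by rw [hB]; linarith [ht v hv]) hc (fun v => by rw [hB]; linarith [hcA v])
  refine ⟨t + c' / (‖J‖ ^ 2 + 1), by linarith [show 0 < c' / (‖J‖ ^ 2 + 1) by positivity],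
    fun v => ?_⟩
  have h : c' / (‖J‖ ^ 2 + 1) * ‖J v‖ ^ 2 ≤ c' * ‖v‖ * ‖v‖ :=
    calc c' / (‖J‖ ^ 2 + 1) * ‖J v‖ ^ 2
        ≤ c' / (‖J‖ ^ 2 + 1) * (‖J‖ * ‖v‖) ^ 2 := by gcongr; exact J.le_opNorm v
      _ = ‖J‖ ^ 2 / (‖J‖ ^ 2 + 1) * (c' * ‖v‖ * ‖v‖) := by ring
      _ ≤ 1 * (c' * ‖v‖ * ‖v‖) := by
          gcongr
          exact div_le_one_of_le₀ (by linarith) (by positivity)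
      _ = c' * ‖v‖ * ‖v‖ := one_mul _
  have hv := hcB v
  rw [hB] at hv
  linarith

/-- The largest `t` with `t ‖J v‖² ≤ A v v` is an eigenvalue: otherwise the difference of the two
sides would be positive definite, and `t` could be increased. -/
theorem exists_minimal_eigenvalue [CompleteSpace V] [NormedAddCommGroup W] [InnerProductSpace ℝ W]
    {A : V →L[ℝ] V →L[ℝ] ℝ} (hsymm : ∀ v w, A v w = A w v) (hA : IsCoercive A) {J : V →L[ℝ] W}
    (hJ : IsCompactOperator J) (hJ0 : J ≠ 0) :
    ∃ t : ℝ, (∃ u, u ≠ 0 ∧ ∀ w, A u w = t * inner ℝ (J u) (J w)) ∧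
      ∀ v, t * ‖J v‖ ^ 2 ≤ A v v := by
  let S : Set ℝ := {t | ∀ v, t * ‖J v‖ ^ 2 ≤ A v v}
  obtain ⟨v₀, hv₀⟩ := DFunLike.ne_iff.1 hJ0
  have hbdd : BddAbove S := ⟨A v₀ v₀ / ‖J v₀‖ ^ 2, fun t ht => by
    rw [le_div_iff₀ (pow_pos (norm_pos_iff.2 hv₀) 2)]; exact ht v₀⟩
  have hclosed : IsClosed S := by
    simp only [S, Set.ofPred_forall]
    exact isClosed_iInter fun v => isClosed_le (by fun_prop) continuous_const
  have hS : S.Nonempty := by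
    obtain ⟨c, hc, hcA⟩ := hA
    exact ⟨0, fun v => by simpa using le_trans (by positivity) (hcA v)⟩
  have hmem : ∀ v, sSup S * ‖J v‖ ^ 2 ≤ A v v := hclosed.csSup_mem hS hbdd
  refine ⟨sSup S, ?_, hmem⟩
  obtain ⟨u, hu0, hu⟩ : ∃ u, u ≠ 0 ∧ A u u ≤ sSup S * ‖J u‖ ^ 2 := by
    by_contra! h
    obtain ⟨t, hlt, ht⟩ := exists_lt_forall_mul_norm_sq_le hA hJ h
    exact hlt.not_ge (le_csSup hbdd ht)
  let B := (A - sSup S • pullbackInner J).toBilinForm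
  have hB (v w : V) : B v w = A v w - sSup S * inner ℝ (J v) (J w) := rfl
  have hB0 (v : V) : 0 ≤ B v v := by
    rw [hB, real_inner_self_eq_norm_sq]; linarith [hmem v]
  have hBu : B u u = 0 := le_antisymm
    (by rw [hB, real_inner_self_eq_norm_sq]; linarith) (hB0 u)
  have hBsymm : LinearMap.IsSymm B := ⟨fun v w => by simp [hB, hsymm v w, real_inner_comm (J v)]⟩
  refine ⟨u, hu0, fun w => ?_⟩
  have hker := (B.apply_apply_same_eq_zero_iff hB0 hBsymm).1 hBu
  have := LinearMap.congr_fun (LinearMap.mem_ker.1 hker) w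
  rw [hB] at this
  simpa [sub_eq_zero] using this

end Forms

/-! ### Translations and ball averages of `C¹` functions -/

section Averages

theorem eLpNorm_two_sq {X F : Type*} [MeasurableSpace X] {μ : Measure X} [NormedAddCommGroup F]
    (f : X → F) : eLpNorm f 2 μ ^ 2 = ∫⁻ x, ‖f x‖ₑ ^ 2 ∂μ := by
  simpa using eLpNorm_nnreal_pow_eq_lintegral (f := f) (μ := μ) (p := 2) two_ne_zero

theorem enorm_integral_sq_le {X F : Type*} [MeasurableSpace X] {μ : Measure X}
    [IsProbabilityMeasure μ] [NormedAddCommGroup F] [NormedSpace ℝ F] (f : X → F) :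
    ‖∫ x, f x ∂μ‖ₑ ^ 2 ≤ ∫⁻ x, ‖f x‖ₑ ^ 2 ∂μ := by
  by_cases hf : AEStronglyMeasurable f μ
  · rw [← eLpNorm_two_sq]
    gcongr
    calc ‖∫ x, f x ∂μ‖ₑ ≤ eLpNorm f 1 μ := by
          rw [eLpNorm_one_eq_lintegral_enorm]; exact enorm_integral_le_lintegral_enorm f
      _ ≤ eLpNorm f 2 μ := eLpNorm_le_eLpNorm_of_exponent_le one_le_two hf
  · simp [integral_non_aestronglyMeasurable hf]

theorem enorm_sub_setAverage_sq_le {X F : Type*} [MeasurableSpace X] {μ : Measure X}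
    [NormedAddCommGroup F] [NormedSpace ℝ F] [CompleteSpace F] {s : Set X} (hs₀ : μ s ≠ 0)
    (hs : μ s ≠ ⊤) {f : X → F} (hf : IntegrableOn f s μ) (a : F) :
    ‖a - ⨍ y in s, f y ∂μ‖ₑ ^ 2 ≤ (μ s)⁻¹ * ∫⁻ y in s, ‖a - f y‖ₑ ^ 2 ∂μ := by
  have : IsProbabilityMeasure ((μ s)⁻¹ • μ.restrict s) :=
    ⟨by simp [ENNReal.inv_mul_cancel hs₀ hs]⟩
  have hsub : a - ⨍ y in s, f y ∂μ = ∫ y, (a - f y) ∂((μ s)⁻¹ • μ.restrict s) := by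
    rw [integral_sub (integrable_const a) (hf.smul_measure (by simpa using hs₀)),
      setAverage_eq', integral_const, probReal_univ, one_smul]
  rw [hsub, ← smul_eq_mul, ← lintegral_smul_measure]
  exact enorm_integral_sq_le _

variable {V F : Type*} [NormedAddCommGroup V] [NormedSpace ℝ V] [NormedAddCommGroup F]
  [NormedSpace ℝ F] [CompleteSpace F] {φ : V → F}

theorem enorm_translate_sub_sq_le (hφ : ContDiff ℝ 1 φ) (x z : V) :
    ‖φ (x + z) - φ x‖ₑ ^ 2 ≤
      ‖z‖ₑ ^ 2 * ∫⁻ t in Set.Icc (0 : ℝ) 1, ‖fderiv ℝ φ (x + t • z)‖ₑ ^ 2 := by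
  have : IsProbabilityMeasure (volume.restrict (Set.Icc (0 : ℝ) 1)) := ⟨by simp⟩
  have hcont : Continuous fun t : ℝ => fderiv ℝ φ (x + t • z) :=
    (hφ.continuous_fderiv one_ne_zero).comp (by fun_prop)
  have hderiv (t : ℝ) :
      HasDerivAt (fun t : ℝ => φ (x + t • z)) (fderiv ℝ φ (x + t • z) z) t :=
    ((hφ.differentiable one_ne_zero) _).hasFDerivAt.comp_hasDerivAt t
      (by simpa using ((hasDerivAt_id t).smul_const z).const_add x)
  have hftc : φ (x + z) - φ x = ∫ t in Set.Icc (0 : ℝ) 1, fderiv ℝ φ (x + t • z) z := by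
    rw [integral_Icc_eq_integral_Ioc, ← intervalIntegral.integral_of_le zero_le_one,
      intervalIntegral.integral_eq_sub_of_hasDerivAt (fun t _ => hderiv t)
        ((hcont.clm_apply continuous_const).intervalIntegrable 0 1)]
    simp
  calc ‖φ (x + z) - φ x‖ₑ ^ 2
      ≤ ∫⁻ t in Set.Icc (0 : ℝ) 1, ‖fderiv ℝ φ (x + t • z) z‖ₑ ^ 2 := by
        rw [hftc]; exact enorm_integral_sq_le _
    _ ≤ ∫⁻ t in Set.Icc (0 : ℝ) 1, ‖z‖ₑ ^ 2 * ‖fderiv ℝ φ (x + t • z)‖ₑ ^ 2 := by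
        refine lintegral_mono fun t => ?_
        rw [← mul_pow, mul_comm]
        gcongr
        exact ContinuousLinearMap.le_opENorm _ _
    _ = ‖z‖ₑ ^ 2 * ∫⁻ t in Set.Icc (0 : ℝ) 1, ‖fderiv ℝ φ (x + t • z)‖ₑ ^ 2 :=
        lintegral_const_mul' _ _ (by finiteness)

variable [FiniteDimensional ℝ V] [MeasurableSpace V] [BorelSpace V] (μ : Measure V)
  [μ.IsAddHaarMeasure]

theorem eLpNorm_translate_sub_le (hφ : ContDiff ℝ 1 φ) (z : V) :
    eLpNorm (fun x => φ (x + z) - φ x) 2 μ ≤ ‖z‖ₑ * eLpNorm (fderiv ℝ φ) 2 μ := by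
  rw [← ENNReal.pow_le_pow_left_iff two_ne_zero, mul_pow, eLpNorm_two_sq, eLpNorm_two_sq]
  have hcont : Continuous fun p : V × ℝ => fderiv ℝ φ (p.1 + p.2 • z) :=
    (hφ.continuous_fderiv one_ne_zero).comp (by fun_prop)
  have hmeas : Measurable (Function.uncurry fun (x : V) (t : ℝ) =>
      ‖fderiv ℝ φ (x + t • z)‖ₑ ^ 2) :=
    ((ENNReal.continuous_pow 2).comp hcont.enorm).measurable
  calc ∫⁻ x, ‖φ (x + z) - φ x‖ₑ ^ 2 ∂μ
      ≤ ∫⁻ x, (‖z‖ₑ ^ 2 * ∫⁻ t in Set.Icc (0 : ℝ) 1, ‖fderiv ℝ φ (x + t • z)‖ₑ ^ 2) ∂μ :=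
        lintegral_mono fun x => enorm_translate_sub_sq_le hφ x z
    _ = ‖z‖ₑ ^ 2 * ∫⁻ t in Set.Icc (0 : ℝ) 1, (∫⁻ x, ‖fderiv ℝ φ (x + t • z)‖ₑ ^ 2 ∂μ) := by
        rw [lintegral_const_mul' _ _ (by finiteness), lintegral_lintegral_swap hmeas.aemeasurable]
    _ = ‖z‖ₑ ^ 2 * ∫⁻ x, ‖fderiv ℝ φ x‖ₑ ^ 2 ∂μ := by
        simp [lintegral_add_right_eq_self (μ := μ) fun x => ‖fderiv ℝ φ x‖ₑ ^ 2]

theorem enorm_sub_ballAverage_sq_le (hφ : Continuous φ) {h : ℝ} (hh : 0 < h) {x y : V}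
    (hx : x ∈ Metric.ball y h) :
    ‖φ x - ⨍ z in Metric.ball y h, φ z ∂μ‖ₑ ^ 2 ≤ (μ (Metric.ball 0 h))⁻¹ *
      ∫⁻ z in Metric.ball 0 (2 * h), ‖φ (x + z) - φ x‖ₑ ^ 2 ∂μ := by
  have hint : IntegrableOn φ (Metric.ball y h) μ :=
    (hφ.continuousOn.integrableOn_compact (isCompact_closedBall y h)).mono_set
      Metric.ball_subset_closedBall
  have hsub : Metric.ball y h ⊆ Metric.ball x (2 * h) :=
    Metric.ball_subset_ball' (by linarith [Metric.mem_ball'.1 hx])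
  have htranslate : ∫⁻ z in Metric.ball x (2 * h), ‖φ z - φ x‖ₑ ^ 2 ∂μ =
      ∫⁻ z in Metric.ball 0 (2 * h), ‖φ (x + z) - φ x‖ₑ ^ 2 ∂μ := by
    rw [← (measurePreserving_add_left μ x).setLIntegral_comp_preimage_emb
      (MeasurableEquiv.addLeft x).measurableEmbedding, preimage_add_ball, sub_self]
  calc ‖φ x - ⨍ z in Metric.ball y h, φ z ∂μ‖ₑ ^ 2
      ≤ (μ (Metric.ball y h))⁻¹ * ∫⁻ z in Metric.ball y h, ‖φ x - φ z‖ₑ ^ 2 ∂μ :=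
        enorm_sub_setAverage_sq_le (Metric.measure_ball_pos _ _ hh).ne' measure_ball_lt_top.ne
          hint _
    _ ≤ (μ (Metric.ball 0 h))⁻¹ * ∫⁻ z in Metric.ball x (2 * h), ‖φ z - φ x‖ₑ ^ 2 ∂μ := by
        rw [Measure.addHaar_ball_center]
        simp_rw [enorm_sub_rev (φ x)]
        gcongr
    _ = _ := by rw [htranslate]

/-- Averaging the translation inequality over the ball of radius `2h`; the constant comes from
`|B(2h)| = 2 ^ d |B(h)|`. -/
theorem lintegral_ballAverage_translate_sub_sq_le (hφ : ContDiff ℝ 1 φ) {h : ℝ} (hh : 0 < h) :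
    ∫⁻ x, ((μ (Metric.ball 0 h))⁻¹ *
        ∫⁻ z in Metric.ball 0 (2 * h), ‖φ (x + z) - φ x‖ₑ ^ 2 ∂μ) ∂μ ≤
      2 ^ Module.finrank ℝ V * (ENNReal.ofReal (2 * h) * eLpNorm (fderiv ℝ φ) 2 μ) ^ 2 := by
  set v := μ (Metric.ball 0 h)
  have hv : v ≠ 0 := (Metric.measure_ball_pos _ _ hh).ne'
  have hv' : v ≠ ⊤ := measure_ball_lt_top.ne
  have hdouble : μ (Metric.ball 0 (2 * h)) = 2 ^ Module.finrank ℝ V * v := by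
    rw [Measure.addHaar_ball_mul_of_pos μ 0 two_pos h, ENNReal.ofReal_pow zero_le_two,
      ENNReal.ofReal_ofNat]
  have hmeas : Measurable (Function.uncurry fun x z : V => ‖φ (x + z) - φ x‖ₑ ^ 2) := by
    have hcont : Continuous fun p : V × V => φ (p.1 + p.2) - φ p.1 :=
      (hφ.continuous.comp continuous_add).sub (hφ.continuous.comp continuous_fst)
    exact ((ENNReal.continuous_pow 2).comp hcont.enorm).measurable
  calc ∫⁻ x, (v⁻¹ * ∫⁻ z in Metric.ball 0 (2 * h), ‖φ (x + z) - φ x‖ₑ ^ 2 ∂μ) ∂μ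
      = v⁻¹ * ∫⁻ z in Metric.ball 0 (2 * h), (∫⁻ x, ‖φ (x + z) - φ x‖ₑ ^ 2 ∂μ) ∂μ := by
        rw [lintegral_const_mul' _ _ (ENNReal.inv_ne_top.2 hv),
          lintegral_lintegral_swap hmeas.aemeasurable]
    _ ≤ v⁻¹ * ∫⁻ _ in Metric.ball 0 (2 * h),
          (ENNReal.ofReal (2 * h) * eLpNorm (fderiv ℝ φ) 2 μ) ^ 2 ∂μ := by
        gcongr v⁻¹ * ?_
        refine setLIntegral_mono' measurableSet_ball fun z hz => ?_
        rw [← eLpNorm_two_sq]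
        gcongr
        refine (eLpNorm_translate_sub_le μ hφ z).trans ?_
        rw [← ofReal_norm]
        gcongr
        exact (mem_ball_zero_iff.1 hz).le
    _ = v⁻¹ * v * (2 ^ Module.finrank ℝ V *
          (ENNReal.ofReal (2 * h) * eLpNorm (fderiv ℝ φ) 2 μ) ^ 2) := by
        rw [setLIntegral_const, hdouble]; ring
    _ = _ := by rw [ENNReal.inv_mul_cancel hv hv', one_mul]

theorem eLpNorm_sub_ballAverage_le (hφ : ContDiff ℝ 1 φ) {h : ℝ} (hh : 0 < h) {A : Set V}
    (hA : MeasurableSet A) {c : V → V} (hc : ∀ x ∈ A, x ∈ Metric.ball (c x) h) :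
    eLpNorm (fun x => φ x - ⨍ y in Metric.ball (c x) h, φ y ∂μ) 2 (μ.restrict A) ≤
      2 ^ Module.finrank ℝ V * ENNReal.ofReal (2 * h) * eLpNorm (fderiv ℝ φ) 2 μ := by
  rw [← ENNReal.pow_le_pow_left_iff two_ne_zero, eLpNorm_two_sq]
  calc ∫⁻ x in A, ‖φ x - ⨍ y in Metric.ball (c x) h, φ y ∂μ‖ₑ ^ 2 ∂μ
      ≤ ∫⁻ x in A, ((μ (Metric.ball 0 h))⁻¹ *
          ∫⁻ z in Metric.ball 0 (2 * h), ‖φ (x + z) - φ x‖ₑ ^ 2 ∂μ) ∂μ :=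
        setLIntegral_mono' hA fun x hx =>
          enorm_sub_ballAverage_sq_le μ hφ.continuous hh (hc x hx)
    _ ≤ 2 ^ Module.finrank ℝ V * (ENNReal.ofReal (2 * h) * eLpNorm (fderiv ℝ φ) 2 μ) ^ 2 :=
        (setLIntegral_le_lintegral _ _).trans
          (lintegral_ballAverage_translate_sub_sq_le μ hφ hh)
    _ ≤ (2 ^ Module.finrank ℝ V) ^ 2 *
          (ENNReal.ofReal (2 * h) * eLpNorm (fderiv ℝ φ) 2 μ) ^ 2 := by
        gcongr ?_ * _
        exact le_self_pow₀ (one_le_pow₀ one_le_two) two_ne_zero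
    _ = _ := by ring

end Averages

/-! ### Poincaré and Sobolev inequalities for test functions -/

section TestFunctions

theorem exists_eLpNorm_le_mul_eLpNorm {X F : Type*} [MeasurableSpace X] [NormedAddCommGroup F]
    (μ : Measure X) [IsFiniteMeasure μ] {p q : ℝ≥0∞} (hpq : p ≤ q) :
    ∃ D : ℝ≥0, ∀ f : X → F, AEStronglyMeasurable f μ → eLpNorm f p μ ≤ D * eLpNorm f q μ := by
  obtain rfl | hp := eq_or_ne p 0
  · exact ⟨0, fun f _ => by simp⟩
  have hexp : 0 ≤ 1 / p.toReal - 1 / q.toReal := by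
    obtain rfl | hq := eq_or_ne q ⊤
    · simp
    · exact sub_nonneg.2 (one_div_le_one_div_of_le
        (ENNReal.toReal_pos hp (ne_top_of_le_ne_top hq hpq)) (ENNReal.toReal_mono hq hpq))
  refine ⟨(μ Set.univ ^ (1 / p.toReal - 1 / q.toReal)).toNNReal, fun f hf => ?_⟩
  rw [ENNReal.coe_toNNReal (ENNReal.rpow_ne_top_of_nonneg hexp (measure_ne_top μ _)), mul_comm]
  exact eLpNorm_le_eLpNorm_mul_rpow_measure_univ hpq hf

variable {N : ℕ} {Ω : Set (Space N)} {φ : Space N → ℝ}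

theorem enorm_gradient (φ : Space N → ℝ) (x : Space N) : ‖∇ φ x‖ₑ = ‖fderiv ℝ φ x‖ₑ := by
  rw [gradient, LinearIsometryEquiv.enorm_map]

theorem isFiniteMeasure_vol (hΩb : Bornology.IsBounded Ω) : IsFiniteMeasure (vol Ω) :=
  isFiniteMeasure_restrict.2 hΩb.measure_lt_top.ne

namespace IsTestFunction

theorem contDiff_one (h : IsTestFunction Ω φ) : ContDiff ℝ 1 φ :=
  h.smooth.of_le (by simp)

theorem eq_zero (h : IsTestFunction Ω φ) {x : Space N} (hx : x ∉ Ω) : φ x = 0 :=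
  image_eq_zero_of_notMem_tsupport fun h' => hx (h.support h')

theorem continuous_gradient (h : IsTestFunction Ω φ) : Continuous (∇ φ) :=
  (LinearIsometryEquiv.continuous _).comp (h.contDiff_one.continuous_fderiv one_ne_zero)

theorem eLpNorm_fderiv (h : IsTestFunction Ω φ) (p : ℝ≥0∞) :
    eLpNorm (fderiv ℝ φ) p volume = eLpNorm (∇ φ) p (vol Ω) := by
  rw [← eLpNorm_restrict_eq_of_support_subset
    (f := fderiv ℝ φ) ((support_fderiv_subset ℝ).trans h.support)]
  exact (eLpNorm_congr_enorm_ae (.of_forall (enorm_gradient φ))).symm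

end IsTestFunction

/-- If `z` is longer than the diameter of `Ω`, then `φ x = -(φ (x + z) - φ x)` for `x ∈ Ω`. -/
theorem exists_poincare_test (hN : 1 ≤ N) (hΩb : Bornology.IsBounded Ω) :
    ∃ C : ℝ≥0, ∀ φ : Space N → ℝ, IsTestFunction Ω φ →
      eLpNorm φ 2 (vol Ω) ≤ C * eLpNorm (∇ φ) 2 (vol Ω) := by
  let z : Space N := EuclideanSpace.single ⟨0, hN⟩ (Metric.diam Ω + 1)
  have hz : ‖z‖ = Metric.diam Ω + 1 := by
    simp [z, abs_of_nonneg (add_nonneg Metric.diam_nonneg zero_le_one)]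
  have hleave {x : Space N} (hx : x ∈ Ω) : x + z ∉ Ω := fun hxz => by
    have hdist := Metric.dist_le_diam_of_mem hΩb hxz hx
    rw [dist_eq_norm, add_sub_cancel_left, hz] at hdist
    linarith
  refine ⟨‖z‖₊, fun φ h => ?_⟩
  calc eLpNorm φ 2 (vol Ω) ≤ eLpNorm (fun x => φ (x + z) - φ x) 2 (vol Ω) := by
        refine eLpNorm_mono_enorm fun x => ?_
        by_cases hx : x ∈ Ω
        · rw [h.eq_zero (hleave hx), zero_sub, enorm_neg]
        · rw [h.eq_zero hx, enorm_zero]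
          exact zero_le
    _ ≤ eLpNorm (fun x => φ (x + z) - φ x) 2 volume := eLpNorm_restrict_le _ _ _ _
    _ ≤ ‖z‖ₑ * eLpNorm (fderiv ℝ φ) 2 volume := eLpNorm_translate_sub_le volume h.contDiff_one z
    _ = ‖z‖₊ * eLpNorm (∇ φ) 2 (vol Ω) := by rw [h.eLpNorm_fderiv]; rfl

theorem enorm_le_eLpNorm_fderiv_of_dim_one {φ : Space 1 → ℝ} (hφ : ContDiff ℝ 1 φ)
    (hφc : HasCompactSupport φ) (x : Space 1) : ‖φ x‖ₑ ≤ eLpNorm (fderiv ℝ φ) 1 volume := by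
  let e : ℝ ≃ₗᵢ[ℝ] Space 1 := (OrthonormalBasis.singleton (Fin 1) ℝ).repr
  have hderiv (t : ℝ) : ‖deriv (φ ∘ e) t‖ₑ ≤ ‖fderiv ℝ φ (e t)‖ₑ := by
    rw [((hφ.differentiable one_ne_zero _).hasFDerivAt.comp_hasDerivAt t
      (by simpa using e.toContinuousLinearEquiv.toContinuousLinearMap.hasDerivAt)).deriv]
    refine (ContinuousLinearMap.le_opENorm _ (e 1)).trans_eq ?_
    rw [LinearIsometryEquiv.enorm_map, enorm_one, mul_one]
  calc ‖φ x‖ₑ = ‖(φ ∘ e) (e.symm x)‖ₑ := by simp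
    _ ≤ ∫⁻ t in Set.Iic (e.symm x), ‖deriv (φ ∘ e) t‖ₑ :=
        HasCompactSupport.enorm_le_lintegral_Ici_deriv (hφ.comp e.contDiff)
          (hφc.comp_homeomorph e.toHomeomorph) _
    _ ≤ ∫⁻ t, ‖fderiv ℝ φ (e t)‖ₑ := (setLIntegral_le_lintegral _ _).trans (lintegral_mono hderiv)
    _ = eLpNorm (fderiv ℝ φ) 1 volume := by
        rw [eLpNorm_one_eq_lintegral_enorm,
          ← e.measurePreserving.lintegral_comp_emb e.toHomeomorph.measurableEmbedding]

theorem exists_sobolev_test_of_dim_one {Ω : Set (Space 1)}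
    (hΩb : Bornology.IsBounded Ω) (q : ℝ≥0∞) :
    ∃ C : ℝ≥0, ∀ φ : Space 1 → ℝ, IsTestFunction Ω φ →
      eLpNorm φ q (vol Ω) ≤ C * eLpNorm (∇ φ) 1 (vol Ω) := by
  have := isFiniteMeasure_vol hΩb
  obtain ⟨C, hC⟩ := exists_eLpNorm_le_mul_eLpNorm (F := ℝ) (vol Ω) (le_top : q ≤ ⊤)
  refine ⟨C, fun φ h => (hC φ h.smooth.continuous.aestronglyMeasurable).trans ?_⟩
  gcongr
  rw [eLpNorm_exponent_top, ← h.eLpNorm_fderiv]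
  exact eLpNormEssSup_le_of_ae_enorm_bound
    (.of_forall (enorm_le_eLpNorm_fderiv_of_dim_one h.contDiff_one h.compact))

theorem exists_sobolev_test_of_lt_dim (hΩb : Bornology.IsBounded Ω) {p q : ℝ≥0}
    (hp : 1 ≤ p) (hpN : p < N) (hpq : (p : ℝ)⁻¹ - (N : ℝ)⁻¹ ≤ (q : ℝ)⁻¹) :
    ∃ C : ℝ≥0, ∀ φ : Space N → ℝ, IsTestFunction Ω φ →
      eLpNorm φ q (vol Ω) ≤ C * eLpNorm (∇ φ) p (vol Ω) := by
  refine ⟨eLpNormLESNormFDerivOfLeConst ℝ volume Ω p q, fun φ h => ?_⟩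
  rw [← h.eLpNorm_fderiv]
  exact (eLpNorm_restrict_le _ _ _ _).trans <|
    eLpNorm_le_eLpNorm_fderiv_of_le volume h.contDiff_one ((subset_tsupport φ).trans h.support) hp
      (by simpa using hpN) (by simpa using hpq) hΩb

theorem exists_sobolev_four_test (hN : 1 ≤ N) (hN' : N ≤ 4)
    (hΩb : Bornology.IsBounded Ω) :
    ∃ C : ℝ≥0, ∀ φ : Space N → ℝ, IsTestFunction Ω φ →
      eLpNorm φ 4 (vol Ω) ≤ C * eLpNorm (∇ φ) 2 (vol Ω) := by
  have := isFiniteMeasure_vol hΩb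
  suffices ∃ p ≤ (2 : ℝ≥0∞), ∃ C : ℝ≥0, ∀ φ : Space N → ℝ, IsTestFunction Ω φ →
      eLpNorm φ 4 (vol Ω) ≤ C * eLpNorm (∇ φ) p (vol Ω) by
    obtain ⟨p, hp, C, hC⟩ := this
    obtain ⟨D, hD⟩ := exists_eLpNorm_le_mul_eLpNorm (F := Space N) (vol Ω) hp
    refine ⟨C * D, fun φ h => (hC φ h).trans ?_⟩
    rw [ENNReal.coe_mul, mul_assoc]
    gcongr
    exact hD _ h.continuous_gradient.aestronglyMeasurable
  obtain rfl | rfl | hN3 : N = 1 ∨ N = 2 ∨ 3 ≤ N := by omega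
  · exact ⟨1, one_le_two, exists_sobolev_test_of_dim_one hΩb 4⟩
  · refine ⟨(4 / 3 : ℝ≥0), ?_, exists_sobolev_test_of_lt_dim hΩb (q := 4) ?_ ?_ ?_⟩
    · rw [← ENNReal.coe_ofNat, ENNReal.coe_le_coe, div_le_iff₀ (by norm_num)]; norm_num
    · rw [le_div_iff₀ (by norm_num)]; norm_num
    · rw [div_lt_iff₀ (by norm_num)]; norm_num
    · norm_num
  · refine ⟨(2 : ℝ≥0), le_rfl, exists_sobolev_test_of_lt_dim hΩb (q := 4) one_le_two ?_ ?_⟩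
    · exact_mod_cast hN3
    · have : (4 : ℝ)⁻¹ ≤ (N : ℝ)⁻¹ := inv_anti₀ (by positivity) (by exact_mod_cast hN')
      norm_num
      linarith

end TestFunctions

/-! ### Averaging operators on `L²(Ω)` -/

section AveragingOperators

theorem exists_simpleFunc_mem_ball {X : Type*} [PseudoMetricSpace X] [MeasurableSpace X]
    [OpensMeasurableSpace X] [Nonempty X] {A : Set X} (hA : TotallyBounded A) {h : ℝ}
    (hh : 0 < h) : ∃ c : SimpleFunc X X, ∀ x ∈ A, x ∈ Metric.ball (c x) h := by
  obtain ⟨t, ht, hAt⟩ := Metric.totallyBounded_iff.1 hA h hh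
  suffices ∃ c : SimpleFunc X X, ∀ x ∈ ⋃ y ∈ t, Metric.ball y h, x ∈ Metric.ball (c x) h from
    this.imp fun c hc x hx => hc x (hAt hx)
  clear hAt
  induction t, ht using Set.Finite.induction_on with
  | empty => exact ⟨SimpleFunc.const X (Classical.arbitrary X), by simp⟩
  | @insert y t _ _ ih =>
    classical
    obtain ⟨c, hc⟩ := ih
    refine ⟨SimpleFunc.piecewise (Metric.ball y h) Metric.isOpen_ball.measurableSet
      (SimpleFunc.const X y) c, fun x hx => ?_⟩
    by_cases hxy : x ∈ Metric.ball y h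
    · simp [hxy]
    · rw [Set.biUnion_insert] at hx
      simpa [hxy] using hc x (hx.resolve_left hxy)

theorem exists_isCompactOperator_ae_eq_simpleFunc {X E : Type*} [MeasurableSpace X]
    [NormedAddCommGroup E] [NormedSpace ℝ E] (μ : Measure X) [IsFiniteMeasure μ] (p : ℝ≥0∞)
    [Fact (1 ≤ p)] (c : SimpleFunc X (StrongDual ℝ E)) :
    ∃ F : E →L[ℝ] Lp ℝ p μ, IsCompactOperator F ∧ ∀ f, F f =ᵐ[μ] fun x => c x f := by
  classical
  let χ (l : StrongDual ℝ E) : Lp ℝ p μ :=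
    indicatorConstLp p (c.measurableSet_fiber l) (measure_ne_top _ _) 1
  refine ⟨∑ l ∈ c.range, l.smulRight (χ l), ?_, fun f => ?_⟩
  · exact sum_mem (S := compactOperator (RingHom.id ℝ) E (Lp ℝ p μ)) fun l _ =>
      (isCompactOperator_of_locallyCompactSpace_rng
        (ContinuousLinearMap.toSpanSingleton ℝ (χ l))).comp_clm l
  · have hsum : (∑ l ∈ c.range, l.smulRight (χ l)) f = ∑ l ∈ c.range, l f • χ l := by
      simp
    have hterm : ∀ᵐ x ∂μ, ∀ l ∈ c.range, (l f • χ l : Lp ℝ p μ) x = if c x = l then l f else 0 := by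
      refine (Finset.eventually_all _).2 fun l _ => ?_
      filter_upwards [Lp.coeFn_smul (l f) (χ l), indicatorConstLp_coeFn (p := p) (μ := μ)
        (hs := c.measurableSet_fiber l) (hμs := measure_ne_top _ _) (c := (1 : ℝ))] with x hx hx'
      rw [hx, Pi.smul_apply, hx']
      simp [Set.indicator_apply]
    rw [hsum]
    filter_upwards [Lp.coeFn_finsetSum c.range fun l => l f • χ l, hterm] with x hx hx'
    rw [hx, Finset.sum_apply, Finset.sum_congr rfl hx']
    simp

variable {N : ℕ} {Ω : Set (Space N)} {φ : Space N → ℝ}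

theorem IsTestFunction.inner_indicatorConstLp_ball (hφ : IsTestFunction Ω φ)
    [IsFiniteMeasure (vol Ω)] {f : Lp ℝ 2 (vol Ω)} (hf : f =ᵐ[vol Ω] φ) (y : Space N) (h : ℝ) :
    inner ℝ (indicatorConstLp 2 measurableSet_ball (measure_ne_top (vol Ω) (Metric.ball y h)) 1) f =
      ∫ x in Metric.ball y h, φ x := by
  rw [L2.inner_indicatorConstLp_one, integral_congr_ae (ae_restrict_of_ae hf),
    Measure.restrict_comm measurableSet_ball]
  exact setIntegral_eq_integral_of_forall_compl_eq_zero fun x hx => hφ.eq_zero hx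

/-- `F` averages over balls of radius `h = δ / 2 ^ (N + 1)`, whose centres are constant on the
pieces of a finite partition. -/
theorem exists_isCompactOperator_enorm_sub_le (hΩ : IsOpen Ω) (hΩb : Bornology.IsBounded Ω)
    {δ : ℝ≥0} (hδ : 0 < δ) :
    ∃ F : Lp ℝ 2 (vol Ω) →L[ℝ] Lp ℝ 2 (vol Ω), IsCompactOperator F ∧
      ∀ (f : Lp ℝ 2 (vol Ω)) (φ : Space N → ℝ), IsTestFunction Ω φ → f =ᵐ[vol Ω] φ →
        ‖f - F f‖ₑ ≤ δ * eLpNorm (∇ φ) 2 (vol Ω) := by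
  have := isFiniteMeasure_vol hΩb
  obtain ⟨h, hh, hδh⟩ : ∃ h : ℝ, 0 < h ∧ 2 ^ N * ENNReal.ofReal (2 * h) = δ := by
    refine ⟨δ / 2 ^ (N + 1), by positivity, ?_⟩
    rw [← ENNReal.ofReal_ofNat, ← ENNReal.ofReal_pow zero_le_two,
      ← ENNReal.ofReal_mul (by positivity), ← ENNReal.ofReal_coe_nnreal]
    congr 1
    field_simp
    ring
  let average (y : Space N) : StrongDual ℝ (Lp ℝ 2 (vol Ω)) :=
    (volume.real (Metric.ball y h))⁻¹ •
      innerSL ℝ (indicatorConstLp 2 measurableSet_ball (measure_ne_top _ (Metric.ball y h)) 1)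
  obtain ⟨c, hc⟩ :=
    exists_simpleFunc_mem_ball (hΩb.isCompact_closure.totallyBounded.subset subset_closure) hh
  obtain ⟨F, hF, hFc⟩ := exists_isCompactOperator_ae_eq_simpleFunc (vol Ω) 2 (c.map average)
  refine ⟨F, hF, fun f φ hφ hf => ?_⟩
  have hFf : F f =ᵐ[vol Ω] fun x => ⨍ y in Metric.ball (c x) h, φ y := by
    filter_upwards [hFc f] with x hx
    rw [hx, setAverage_eq, ← hφ.inner_indicatorConstLp_ball hf]
    rfl
  calc ‖f - F f‖ₑ = eLpNorm (fun x => φ x - ⨍ y in Metric.ball (c x) h, φ y) 2 (vol Ω) := by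
        rw [Lp.enorm_def, eLpNorm_congr_ae (Lp.coeFn_sub f (F f)), eLpNorm_congr_ae (hf.sub hFf)]
        rfl
    _ ≤ 2 ^ N * ENNReal.ofReal (2 * h) * eLpNorm (fderiv ℝ φ) 2 volume := by
        simpa using eLpNorm_sub_ballAverage_le volume hφ.contDiff_one hh hΩ.measurableSet hc
    _ = δ * eLpNorm (∇ φ) 2 (vol Ω) := by rw [hδh, hφ.eLpNorm_fderiv]

end AveragingOperators

/-! ### The space `H_0^1(Ω)` -/

section SobolevSpace

theorem lowerSemicontinuous_eLpNorm {X F : Type*} [MeasurableSpace X] [NormedAddCommGroup F]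
    (μ : Measure X) (p q : ℝ≥0∞) [Fact (1 ≤ p)] :
    LowerSemicontinuous fun f : Lp F p μ => eLpNorm f q μ := by
  refine lowerSemicontinuous_iff_isClosed_preimage.2 fun y => IsSeqClosed.isClosed ?_
  intro f f₀ hf hff₀
  obtain ⟨k, -, hk⟩ := (tendstoInMeasure_of_tendsto_Lp hff₀).exists_seq_tendsto_ae
  calc eLpNorm f₀ q μ ≤ liminf (fun n => eLpNorm (f (k n)) q μ) atTop :=
        Lp.eLpNorm_lim_le_liminf_eLpNorm (fun n => Lp.aestronglyMeasurable (f (k n))) _ hk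
    _ ≤ liminf (fun _ : ℕ => y) atTop := liminf_le_liminf (.of_forall fun n => hf (k n))
    _ = y := liminf_const y

variable {N : ℕ} {Ω : Set (Space N)}

instance instCompleteSpaceH01 : CompleteSpace (H01 Ω) :=
  (testPairs Ω).isClosed_topologicalClosure.completeSpace_coe

/-- The inclusion `H_0^1(Ω) → L²(Ω)`. -/
def toL2 (Ω : Set (Space N)) : H01 Ω →L[ℝ] Lp ℝ 2 (vol Ω) :=
  (WithLp.fstL 2 ℝ (Lp ℝ 2 (vol Ω)) (Lp (Space N) 2 (vol Ω))).comp (H01 Ω).subtypeL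

/-- The weak gradient as an operator `H_0^1(Ω) → L²(Ω; ℝ^N)`. -/
def gradL2 (Ω : Set (Space N)) : H01 Ω →L[ℝ] Lp (Space N) 2 (vol Ω) :=
  (WithLp.sndL 2 ℝ (Lp ℝ 2 (vol Ω)) (Lp (Space N) 2 (vol Ω))).comp (H01 Ω).subtypeL

theorem coe_toL2 (u : H01 Ω) : (toL2 Ω u : Space N → ℝ) = fn u := rfl

theorem norm_sq_eq_add (u : H01 Ω) : ‖u‖ ^ 2 = ‖toL2 Ω u‖ ^ 2 + ‖gradL2 Ω u‖ ^ 2 :=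
  WithLp.prod_norm_sq_eq_of_L2 (u : L2Pair Ω)

theorem norm_gradL2_le (u : H01 Ω) : ‖gradL2 Ω u‖ ≤ ‖u‖ := by
  refine (sq_le_sq₀ (norm_nonneg _) (norm_nonneg _)).1 ?_
  rw [norm_sq_eq_add]
  exact le_add_of_nonneg_left (sq_nonneg _)

theorem induction_of_isTestFunction {P : Lp ℝ 2 (vol Ω) → Lp (Space N) 2 (vol Ω) → Prop}
    (hP : IsClosed {p : Lp ℝ 2 (vol Ω) × Lp (Space N) 2 (vol Ω) | P p.1 p.2})
    (htest : ∀ (f : Lp ℝ 2 (vol Ω)) (F : Lp (Space N) 2 (vol Ω)) (φ : Space N → ℝ),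
      IsTestFunction Ω φ → f =ᵐ[vol Ω] φ →
      F =ᵐ[vol Ω] ∇ φ → P f F)
    (u : H01 Ω) : P (toL2 Ω u) (gradL2 Ω u) := by
  have hsub : testPairs Ω ≤ {p : L2Pair Ω | P p.fst p.snd} := by
    rintro p ⟨φ, hφ, hf, hF⟩
    exact htest _ _ φ hφ hf hF
  exact closure_minimal hsub (hP.preimage (WithLp.prod_continuous_ofLp 2 _ _)) u.2

theorem map_toL2_le {Φ : Lp ℝ 2 (vol Ω) → ℝ≥0∞} (hΦ : LowerSemicontinuous Φ) {C : ℝ≥0}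
    (htest : ∀ (f : Lp ℝ 2 (vol Ω)) (φ : Space N → ℝ), IsTestFunction Ω φ → f =ᵐ[vol Ω] φ →
      Φ f ≤ C * eLpNorm (∇ φ) 2 (vol Ω))
    (u : H01 Ω) : Φ (toL2 Ω u) ≤ C * ‖gradL2 Ω u‖ₑ := by
  refine induction_of_isTestFunction (P := fun f F => Φ f ≤ C * ‖F‖ₑ) ?_ ?_ u
  · have hcont : Continuous fun p : Lp ℝ 2 (vol Ω) × Lp (Space N) 2 (vol Ω) =>
        (p.1, (C : ℝ≥0∞) * ‖p.2‖ₑ) :=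
      continuous_fst.prodMk ((ENNReal.continuous_const_mul ENNReal.coe_ne_top).comp
        continuous_snd.enorm)
    exact hΦ.isClosed_epigraph.preimage hcont
  · intro f F φ hφ hf hF
    rw [Lp.enorm_def, eLpNorm_congr_ae hF]
    exact htest f φ hφ hf

theorem norm_map_toL2_le {G : Type*} [NormedAddCommGroup G] [NormedSpace ℝ G]
    (T : Lp ℝ 2 (vol Ω) →L[ℝ] G) {C : ℝ≥0}
    (htest : ∀ (f : Lp ℝ 2 (vol Ω)) (φ : Space N → ℝ), IsTestFunction Ω φ → f =ᵐ[vol Ω] φ →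
      ‖T f‖ₑ ≤ C * eLpNorm (∇ φ) 2 (vol Ω)) (u : H01 Ω) :
    ‖T (toL2 Ω u)‖ ≤ C * ‖gradL2 Ω u‖ := by
  have h : ((‖T (toL2 Ω u)‖₊ : ℝ≥0) : ℝ≥0∞) ≤ C * ‖gradL2 Ω u‖₊ :=
    map_toL2_le (Φ := fun f => ‖T f‖ₑ) T.continuous.enorm.lowerSemicontinuous htest u
  exact_mod_cast h

theorem exists_poincare (hN : 1 ≤ N) (hΩb : Bornology.IsBounded Ω) :
    ∃ C : ℝ≥0, ∀ u : H01 Ω, ‖toL2 Ω u‖ ≤ C * ‖gradL2 Ω u‖ := by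
  obtain ⟨C, hC⟩ := exists_poincare_test hN hΩb
  refine ⟨C, norm_map_toL2_le (.id ℝ _) fun f φ hφ hf => ?_⟩
  rw [ContinuousLinearMap.id_apply, Lp.enorm_def, eLpNorm_congr_ae hf]
  exact hC φ hφ

theorem isCompactOperator_toL2 (hΩ : IsOpen Ω) (hΩb : Bornology.IsBounded Ω) :
    IsCompactOperator (toL2 Ω) := by
  refine isClosed_setOfPred_isCompactOperator.closure_subset
    ((Metric.mem_closure_iff (α := H01 Ω →L[ℝ] Lp ℝ 2 (vol Ω))).2 fun r hr => ?_)
  lift r to ℝ≥0 using hr.le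
  obtain ⟨δ, hδ, hδr⟩ := exists_between (NNReal.coe_pos.1 hr)
  obtain ⟨F, hF, hFtest⟩ := exists_isCompactOperator_enorm_sub_le hΩ hΩb hδ
  refine ⟨F.comp (toL2 Ω), hF.comp_clm _, ?_⟩
  have hle : ‖toL2 Ω - F.comp (toL2 Ω)‖ ≤ δ :=
    ContinuousLinearMap.opNorm_le_bound _ δ.2 fun u =>
      (norm_map_toL2_le (.id ℝ _ - F) hFtest u).trans
        (mul_le_mul_of_nonneg_left (norm_gradL2_le u) δ.2)
  exact (dist_eq_norm (toL2 Ω) (F.comp (toL2 Ω))).trans_lt (hle.trans_lt hδr)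

end SobolevSpace

/-! ### Weak gradients and products in `H_0^1(Ω)` -/

section WeakGradient

variable {N : ℕ} {Ω : Set (Space N)} {φ ψ : Space N → ℝ}

theorem IsTestFunction.memLp (hφ : IsTestFunction Ω φ) (p : ℝ≥0∞) : MemLp φ p (vol Ω) :=
  (hφ.smooth.continuous.memLp_of_hasCompactSupport hφ.compact).restrict Ω

theorem IsTestFunction.continuous_fderiv_apply (hφ : IsTestFunction Ω φ) (e : Space N) :
    Continuous fun x => fderiv ℝ φ x e :=
  (hφ.contDiff_one.continuous_fderiv one_ne_zero).clm_apply continuous_const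

theorem IsTestFunction.memLp_fderiv_apply (hφ : IsTestFunction Ω φ) (e : Space N) (p : ℝ≥0∞) :
    MemLp (fun x => fderiv ℝ φ x e) p (vol Ω) :=
  ((hφ.continuous_fderiv_apply e).memLp_of_hasCompactSupport
    (hφ.compact.fderiv_apply ℝ e)).restrict Ω

theorem IsTestFunction.integral_mul_fderiv (hφ : IsTestFunction Ω φ) (hψ : IsTestFunction Ω ψ)
    (e : Space N) :
    ∫ x in Ω, φ x * fderiv ℝ ψ x e = -∫ x in Ω, inner ℝ e (∇ φ x) * ψ x := by
  have hgrad (x : Space N) : inner ℝ e (∇ φ x) = fderiv ℝ φ x e := by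
    rw [gradient, real_inner_comm, InnerProductSpace.toDual_symm_apply]
  simp only [hgrad]
  rw [setIntegral_eq_integral_of_forall_compl_eq_zero fun x hx => by simp [hφ.eq_zero hx],
    setIntegral_eq_integral_of_forall_compl_eq_zero fun x hx => by simp [hψ.eq_zero hx]]
  have cφ := hφ.smooth.continuous
  have cψ := hψ.smooth.continuous
  exact integral_mul_fderiv_eq_neg_fderiv_mul_of_integrable
    (((hφ.continuous_fderiv_apply e).mul cψ).integrable_of_hasCompactSupport hψ.compact.mul_left)
    ((cφ.mul (hψ.continuous_fderiv_apply e)).integrable_of_hasCompactSupport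
      hφ.compact.mul_right)
    ((cφ.mul cψ).integrable_of_hasCompactSupport hφ.compact.mul_right)
    (fun x _ => hφ.contDiff_one.differentiable one_ne_zero x)
    (fun x _ => hψ.contDiff_one.differentiable one_ne_zero x)

theorem integral_fn_mul_fderiv (u : H01 Ω) (hψ : IsTestFunction Ω ψ) (e : Space N) :
    ∫ x in Ω, fn u x * fderiv ℝ ψ x e = -∫ x in Ω, inner ℝ e (grad u x) * ψ x := by
  have hψ' := hψ.memLp_fderiv_apply e 2
  have hψe : MemLp (fun x => ψ x • e) 2 (vol Ω) :=
    (ContinuousLinearMap.toSpanSingleton ℝ e).comp_memLp' (hψ.memLp 2)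
  have inner_left (f : Lp ℝ 2 (vol Ω)) :
      inner ℝ hψ'.toLp f = ∫ x in Ω, f x * fderiv ℝ ψ x e := by
    rw [L2.inner_def]
    refine integral_congr_ae (hψ'.coeFn_toLp.mono fun x hx => ?_)
    simp [hx]
  have inner_right (F : Lp (Space N) 2 (vol Ω)) :
      inner ℝ hψe.toLp F = ∫ x in Ω, inner ℝ e (F x) * ψ x := by
    rw [L2.inner_def]
    refine integral_congr_ae (hψe.coeFn_toLp.mono fun x hx => ?_)
    simp [hx, inner_smul_left, mul_comm]
  have h : inner ℝ hψ'.toLp (toL2 Ω u) = -inner ℝ hψe.toLp (gradL2 Ω u) := by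
    refine induction_of_isTestFunction
      (P := fun f F => inner ℝ hψ'.toLp f = -inner ℝ hψe.toLp F)
      (isClosed_eq (by fun_prop) (by fun_prop)) (fun f F φ hφ hf hF => ?_) u
    rw [inner_left, inner_right]
    calc ∫ x in Ω, f x * fderiv ℝ ψ x e
        = ∫ x in Ω, φ x * fderiv ℝ ψ x e :=
          integral_congr_ae (hf.mono fun x hx => by simp only [hx])
      _ = -∫ x in Ω, inner ℝ e (∇ φ x) * ψ x := hφ.integral_mul_fderiv hψ e
      _ = -∫ x in Ω, inner ℝ e (F x) * ψ x :=
          congrArg _ (integral_congr_ae (hF.mono fun x hx => by simp only [hx]))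
  rwa [inner_left, inner_right] at h

theorem toL2_injective (hΩ : IsOpen Ω) (hΩb : Bornology.IsBounded Ω) :
    Function.Injective (toL2 Ω) := by
  have := isFiniteMeasure_vol hΩb
  refine (injective_iff_map_eq_zero _).2 fun u hu => ?_
  have hfn : fn u =ᵐ[vol Ω] 0 := by
    rw [← coe_toL2, hu]; exact Lp.coeFn_zero _ _ _
  have hint : Integrable (grad u) (vol Ω) := (Lp.memLp (gradL2 Ω u)).integrable one_le_two
  have hgrad : ∀ᵐ x ∂volume, x ∈ Ω → grad u x = 0 := by
    refine hΩ.ae_eq_zero_of_integral_contDiff_smul_eq_zero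
      (IntegrableOn.locallyIntegrableOn hint) fun ψ hψ₁ hψ₂ hψ₃ => ?_
    have hψ : IsTestFunction Ω ψ := ⟨hψ₁, hψ₂, hψ₃⟩
    rw [← setIntegral_eq_integral_of_forall_compl_eq_zero (s := Ω)
      (fun x hx => by simp [hψ.eq_zero hx])]
    have hψu : Integrable (fun x => ψ x • grad u x) (vol Ω) :=
      memLp_one_iff_integrable.1 ((Lp.memLp (gradL2 Ω u)).smul (hψ.memLp 2))
    refine ext_inner_left ℝ fun e => ?_
    calc inner ℝ e (∫ x in Ω, ψ x • grad u x)
        = ∫ x in Ω, inner ℝ e (grad u x) * ψ x := by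
          simp only [← integral_inner hψu, inner_smul_right, mul_comm]
      _ = -∫ x in Ω, fn u x * fderiv ℝ ψ x e := by rw [integral_fn_mul_fderiv u hψ e, neg_neg]
      _ = inner ℝ e (0 : Space N) := by
          rw [integral_eq_zero_of_ae (hfn.mono fun x hx => by simp [hx]), neg_zero,
            inner_zero_right]
  have hgradL2 : gradL2 Ω u = 0 :=
    (Lp.eq_zero_iff_ae_eq_zero).2 ((ae_restrict_iff' hΩ.measurableSet).2 hgrad)
  simpa [hu, hgradL2] using norm_sq_eq_add u

/-- The continuous embedding `H_0^1(Ω) ↪ L⁴(Ω)`. -/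
def HasSobolevL4 (Ω : Set (Space N)) : Prop :=
  ∃ C : ℝ≥0, ∀ u : H01 Ω, eLpNorm (fn u) 4 (vol Ω) ≤ C * ‖u‖ₑ

theorem hasSobolevL4 (hN : 1 ≤ N) (hN' : N ≤ 4) (hΩb : Bornology.IsBounded Ω) :
    HasSobolevL4 Ω := by
  obtain ⟨C, hC⟩ := exists_sobolev_four_test hN hN' hΩb
  refine ⟨C, fun u => (map_toL2_le (lowerSemicontinuous_eLpNorm (vol Ω) 2 4)
    (fun f φ hφ hf => ?_) u).trans (mul_le_mul_right (enorm_le_iff_norm_le.2 (norm_gradL2_le u)) _)⟩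
  rw [eLpNorm_congr_ae hf]
  exact hC φ hφ

theorem HasSobolevL4.memLp_fn (hS : HasSobolevL4 Ω) (u : H01 Ω) : MemLp (fn u) 4 (vol Ω) := by
  obtain ⟨C, hC⟩ := hS
  exact ⟨Lp.aestronglyMeasurable (toL2 Ω u), (hC u).trans_lt (by finiteness)⟩

instance instFactOneLeFour : Fact ((1 : ℝ≥0∞) ≤ 4) := ⟨by norm_num⟩

instance instHolderTripleFourFourTwo : ENNReal.HolderTriple 4 4 2 := ⟨by
  rw [← two_mul, show (4 : ℝ≥0∞) = 2 * 2 by norm_num, ENNReal.mul_inv (by simp) (by simp),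
    ← mul_assoc, ENNReal.mul_inv_cancel (by simp) (by simp), one_mul]⟩

/-- The embedding `H_0^1(Ω) → L⁴(Ω)` as an operator. -/
def toL4 (hS : HasSobolevL4 Ω) : H01 Ω →L[ℝ] Lp ℝ 4 (vol Ω) :=
  LinearMap.mkContinuousOfExistsBound
    { toFun := fun u => (hS.memLp_fn u).toLp
      map_add' := fun u v => MemLp.toLp_congr _ ((hS.memLp_fn u).add (hS.memLp_fn v))
        (Lp.coeFn_add (toL2 Ω u) (toL2 Ω v))
      map_smul' := fun c u => MemLp.toLp_congr _ ((hS.memLp_fn u).const_smul c)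
        (Lp.coeFn_smul c (toL2 Ω u)) }
    (by
      obtain ⟨C, hC⟩ := id hS
      refine ⟨C, fun u => ?_⟩
      change ‖(hS.memLp_fn u).toLp‖ ≤ _
      rw [Lp.norm_toLp]
      refine ENNReal.toReal_le_of_le_ofReal (by positivity) ((hC u).trans_eq ?_)
      rw [ENNReal.ofReal_mul C.coe_nonneg, ofReal_norm, ENNReal.ofReal_coe_nnreal])

theorem coeFn_toL4 (hS : HasSobolevL4 Ω) (u : H01 Ω) : toL4 hS u =ᵐ[vol Ω] fn u :=
  (hS.memLp_fn u).coeFn_toLp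

/-- The product of two functions in `H_0^1(Ω)`, as a bounded bilinear map into `L²(Ω)`. -/
def mulH01 (hS : HasSobolevL4 Ω) : H01 Ω →L[ℝ] H01 Ω →L[ℝ] Lp ℝ 2 (vol Ω) :=
  ((ContinuousLinearMap.mul ℝ ℝ).holderL (vol Ω) 4 4 2).bilinearComp (toL4 hS) (toL4 hS)

theorem coeFn_mulH01 (hS : HasSobolevL4 Ω) (u v : H01 Ω) :
    mulH01 hS u v =ᵐ[vol Ω] fun x => fn u x * fn v x := by
  filter_upwards [(ContinuousLinearMap.mul ℝ ℝ).coeFn_holder (r := 2) (toL4 hS u) (toL4 hS v),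
    coeFn_toL4 hS u, coeFn_toL4 hS v] with x h hu hv
  rw [hu, hv] at h
  exact h

end WeakGradient

/-! ### The first eigenvalue and Schrödinger forms -/

section Eigenvalue

variable {N : ℕ} {Ω : Set (Space N)}

theorem inner_gradL2 (u v : H01 Ω) :
    inner ℝ (gradL2 Ω u) (gradL2 Ω v) = ∫ x in Ω, inner ℝ (grad u x) (grad v x) := rfl

theorem inner_toL2 (u v : H01 Ω) :
    inner ℝ (toL2 Ω u) (toL2 Ω v) = ∫ x in Ω, fn u x * fn v x := by
  simp only [L2.inner_def, coe_toL2, RCLike.inner_apply, conj_trivial, mul_comm]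

theorem isCoercive_pullbackInner_gradL2 (hN : 1 ≤ N) (hΩb : Bornology.IsBounded Ω) :
    IsCoercive (pullbackInner (gradL2 Ω)) := by
  obtain ⟨C, hC⟩ := exists_poincare hN hΩb
  refine ⟨((C : ℝ) ^ 2 + 1)⁻¹, by positivity, fun u => ?_⟩
  rw [pullbackInner_apply_self, mul_assoc, ← pow_two, inv_mul_le_iff₀ (by positivity),
    norm_sq_eq_add, add_mul, one_mul, ← mul_pow]
  gcongr
  exact hC u

theorem IsDirichletEigenvalue.nonneg (hΩ : IsOpen Ω) (hΩb : Bornology.IsBounded Ω) {t : ℝ}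
    (ht : IsDirichletEigenvalue Ω t) : 0 ≤ t := by
  obtain ⟨φ, hφ, heq⟩ := ht
  have h := heq φ
  rw [← inner_gradL2, ← inner_toL2, real_inner_self_eq_norm_sq, real_inner_self_eq_norm_sq] at h
  have hφ2 : 0 < ‖toL2 Ω φ‖ ^ 2 :=
    pow_pos (norm_pos_iff.2 ((map_ne_zero_iff _ (toL2_injective hΩ hΩb)).2 hφ)) 2
  exact nonneg_of_mul_nonneg_left (h ▸ sq_nonneg _) hφ2

theorem firstEigenvalue_mul_norm_sq_le (hN : 1 ≤ N) (hΩ : IsOpen Ω)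
    (hΩb : Bornology.IsBounded Ω) (u : H01 Ω) :
    firstEigenvalue Ω * ‖toL2 Ω u‖ ^ 2 ≤ ‖gradL2 Ω u‖ ^ 2 := by
  obtain h0 | h0 := eq_or_ne (toL2 Ω) 0
  · simp [h0]
  obtain ⟨t, ⟨φ, hφ, heq⟩, ht⟩ := exists_minimal_eigenvalue
    (fun v w => real_inner_comm (gradL2 Ω w) (gradL2 Ω v))
    (isCoercive_pullbackInner_gradL2 hN hΩb) (isCompactOperator_toL2 hΩ hΩb) h0
  have hle : firstEigenvalue Ω ≤ t := by
    refine csInf_le ⟨0, fun s hs => hs.nonneg hΩ hΩb⟩ ⟨φ, hφ, fun ψ => ?_⟩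
    rw [← inner_gradL2, ← inner_toL2]
    exact heq ψ
  calc firstEigenvalue Ω * ‖toL2 Ω u‖ ^ 2 ≤ t * ‖toL2 Ω u‖ ^ 2 := by gcongr
    _ ≤ pullbackInner (gradL2 Ω) u u := ht u
    _ = ‖gradL2 Ω u‖ ^ 2 := pullbackInner_apply_self _ u

/-- Multiplication by a bounded function on `L²(Ω)`. -/
def mulL2 {α : Space N → ℝ} (hα : MemLp α ⊤ (vol Ω)) : Lp ℝ 2 (vol Ω) →L[ℝ] Lp ℝ 2 (vol Ω) :=
  (ContinuousLinearMap.mul ℝ ℝ).holderL (vol Ω) ⊤ 2 2 hα.toLp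

theorem coeFn_mulL2 {α : Space N → ℝ} (hα : MemLp α ⊤ (vol Ω)) (f : Lp ℝ 2 (vol Ω)) :
    mulL2 hα f =ᵐ[vol Ω] fun x => α x * f x := by
  filter_upwards [(ContinuousLinearMap.mul ℝ ℝ).coeFn_holder (r := 2) hα.toLp f,
    hα.coeFn_toLp] with x h hx
  rw [hx] at h
  exact h

theorem inner_mulL2_ae_eq {α : Space N → ℝ} (hα : MemLp α ⊤ (vol Ω)) (u : H01 Ω) :
    (fun x => inner ℝ (toL2 Ω u x) (mulL2 hα (toL2 Ω u) x)) =ᵐ[vol Ω]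
      fun x => α x * fn u x ^ 2 := by
  filter_upwards [coeFn_mulL2 hα (toL2 Ω u)] with x hx
  rw [hx, coe_toL2, RCLike.inner_apply, conj_trivial]
  ring

theorem integrable_mul_fn_sq {α : Space N → ℝ} (hα : MemLp α ⊤ (vol Ω)) (u : H01 Ω) :
    Integrable (fun x => α x * fn u x ^ 2) (vol Ω) :=
  (L2.integrable_inner _ _).congr (inner_mulL2_ae_eq hα u)

theorem inner_mulL2 {α : Space N → ℝ} (hα : MemLp α ⊤ (vol Ω)) (u : H01 Ω) :
    inner ℝ (toL2 Ω u) (mulL2 hα (toL2 Ω u)) = ∫ x in Ω, α x * fn u x ^ 2 :=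
  integral_congr_ae (inner_mulL2_ae_eq hα u)

theorem integral_mul_fn_sq_pos (hΩ : IsOpen Ω) (hΩb : Bornology.IsBounded Ω) {α : Space N → ℝ}
    (hα : MemLp α ⊤ (vol Ω)) (hα0 : ∀ᵐ x ∂vol Ω, 0 < α x) {u : H01 Ω} (hu : u ≠ 0) :
    0 < ∫ x in Ω, α x * fn u x ^ 2 := by
  have hnonneg : 0 ≤ᵐ[vol Ω] fun x => α x * fn u x ^ 2 :=
    hα0.mono fun x hx => mul_nonneg hx.le (sq_nonneg _)
  refine (integral_nonneg_of_ae hnonneg).lt_of_ne' fun h0 =>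
    (map_ne_zero_iff _ (toL2_injective hΩ hΩb)).2 hu ((Lp.eq_zero_iff_ae_eq_zero).2 ?_)
  filter_upwards [(integral_eq_zero_iff_of_nonneg_ae hnonneg (integrable_mul_fn_sq hα u)).1 h0,
    hα0] with x hx hx0
  exact pow_eq_zero_iff two_ne_zero |>.1 ((mul_eq_zero.1 hx).resolve_left hx0.ne')

/-- The bilinear form `(u, v) ↦ ∫_Ω (e ∇u · ∇v + α u v)` of the operator `-e Δ + α`. -/
def schrodingerForm (e : ℝ) {α : Space N → ℝ} (hα : MemLp α ⊤ (vol Ω)) :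
    H01 Ω →L[ℝ] H01 Ω →L[ℝ] ℝ :=
  let potential : H01 Ω →L[ℝ] H01 Ω →L[ℝ] ℝ :=
    (innerSL ℝ).bilinearComp (toL2 Ω) ((mulL2 hα).comp (toL2 Ω))
  e • pullbackInner (gradL2 Ω) + potential

theorem schrodingerForm_apply_self (e : ℝ) {α : Space N → ℝ} (hα : MemLp α ⊤ (vol Ω))
    (u : H01 Ω) :
    schrodingerForm e hα u u =
      e * ‖gradL2 Ω u‖ ^ 2 + inner ℝ (toL2 Ω u) (mulL2 hα (toL2 Ω u)) := by
  rw [← pullbackInner_apply_self]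
  rfl

theorem integrable_norm_grad_sq (u : H01 Ω) : Integrable (fun x => ‖grad u x‖ ^ 2) (vol Ω) :=
  (Lp.memLp (gradL2 Ω u)).integrable_norm_pow two_ne_zero

theorem integral_norm_grad_sq (u : H01 Ω) : ∫ x in Ω, ‖grad u x‖ ^ 2 = ‖gradL2 Ω u‖ ^ 2 := by
  simp only [← real_inner_self_eq_norm_sq, inner_gradL2]

theorem integrable_schrodinger (e : ℝ) {α : Space N → ℝ} (hα : MemLp α ⊤ (vol Ω)) (u : H01 Ω) :
    Integrable (fun x => e * ‖grad u x‖ ^ 2 + α x * fn u x ^ 2) (vol Ω) :=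
  ((integrable_norm_grad_sq u).const_mul e).add (integrable_mul_fn_sq hα u)

theorem schrodingerForm_eq_integral (e : ℝ) {α : Space N → ℝ} (hα : MemLp α ⊤ (vol Ω))
    (u : H01 Ω) :
    schrodingerForm e hα u u = ∫ x in Ω, (e * ‖grad u x‖ ^ 2 + α x * fn u x ^ 2) := by
  rw [schrodingerForm_apply_self, integral_add ((integrable_norm_grad_sq u).const_mul e)
    (integrable_mul_fn_sq hα u), integral_const_mul, integral_norm_grad_sq, inner_mulL2]

theorem schrodingerForm_pos (hN : 1 ≤ N) (hΩ : IsOpen Ω) (hΩb : Bornology.IsBounded Ω) {e : ℝ}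
    (he : 0 ≤ e) {α : Space N → ℝ} (hα : MemLp α ⊤ (vol Ω))
    (hα' : ∀ᵐ x ∂vol Ω, -(e * firstEigenvalue Ω) < α x) {u : H01 Ω} (hu : u ≠ 0) :
    0 < schrodingerForm e hα u u := by
  have := isFiniteMeasure_vol hΩb
  set c := e * firstEigenvalue Ω with hc
  have hc_mem : MemLp (fun _ => c) ⊤ (vol Ω) := memLp_const c
  have hpos : 0 < ∫ x in Ω, (c + α x) * fn u x ^ 2 :=
    integral_mul_fn_sq_pos hΩ hΩb (hc_mem.add hα)
      (hα'.mono fun x hx => by simpa using neg_lt_iff_pos_add'.1 hx) hu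
  have hnorm : ∫ x in Ω, fn u x ^ 2 = ‖toL2 Ω u‖ ^ 2 := by
    simp only [pow_two (fn u _), ← inner_toL2, real_inner_self_eq_norm_sq]
  calc 0 < ∫ x in Ω, (c + α x) * fn u x ^ 2 := hpos
    _ = c * ‖toL2 Ω u‖ ^ 2 + ∫ x in Ω, α x * fn u x ^ 2 := by
        simp only [add_mul]
        rw [integral_add (integrable_mul_fn_sq hc_mem u) (integrable_mul_fn_sq hα u),
          integral_const_mul, hnorm]
    _ ≤ e * ‖gradL2 Ω u‖ ^ 2 + ∫ x in Ω, α x * fn u x ^ 2 := by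
        rw [hc, mul_assoc]
        gcongr
        exact firstEigenvalue_mul_norm_sq_le hN hΩ hΩb u
    _ = schrodingerForm e hα u u := by rw [schrodingerForm_apply_self, inner_mulL2]

theorem isCoercive_schrodingerForm (hN : 1 ≤ N) (hΩ : IsOpen Ω) (hΩb : Bornology.IsBounded Ω)
    {e : ℝ} (he : 0 < e) {α : Space N → ℝ} (hα : MemLp α ⊤ (vol Ω))
    (hα' : ∀ᵐ x ∂vol Ω, -(e * firstEigenvalue Ω) < α x) : IsCoercive (schrodingerForm e hα) := by
  refine isCoercive_of_isCompactOperator (isCompactOperator_toL2 hΩ hΩb)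
    (fun u hu => schrodingerForm_pos hN hΩ hΩb he.le hα hα' hu) he (C := e + ‖mulL2 hα‖)
    fun u => ?_
  have hmul : -(‖mulL2 hα‖ * ‖toL2 Ω u‖ ^ 2) ≤ inner ℝ (toL2 Ω u) (mulL2 hα (toL2 Ω u)) :=
    calc -(‖mulL2 hα‖ * ‖toL2 Ω u‖ ^ 2) = -(‖toL2 Ω u‖ * (‖mulL2 hα‖ * ‖toL2 Ω u‖)) := by ring
      _ ≤ -(‖toL2 Ω u‖ * ‖mulL2 hα (toL2 Ω u)‖) := by gcongr; exact (mulL2 hα).le_opNorm _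
      _ ≤ inner ℝ (toL2 Ω u) (mulL2 hα (toL2 Ω u)) :=
        neg_le_of_abs_le (abs_real_inner_le_norm _ _)
  rw [schrodingerForm_apply_self, norm_sq_eq_add]
  linarith

end Eigenvalue

/-! ### Fibering maps -/

section Fibering

/-- The map `s ↦ f (s • v)` is `s ↦ k s² / 2 - l s⁴ / 4`, as it is when `f` is the difference of a
quadratic form with value `k / 2` and a quartic form with value `l / 4` at `v`. -/
def HasFiberingMap {X : Type*} [SMul ℝ X] (f : X → ℝ) (v : X) (k l : ℝ) : Prop :=
  ∀ s : ℝ, f (s • v) = s ^ 2 / 2 * k - s ^ 4 / 4 * l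

theorem HasFiberingMap.hasDerivAt {X : Type*} [SMul ℝ X] {f : X → ℝ} {v : X} {k l : ℝ}
    (h : HasFiberingMap f v k l) (s : ℝ) :
    HasDerivAt (fun r : ℝ => f (r • v)) (s * k - s ^ 3 * l) s := by
  rw [show (fun r : ℝ => f (r • v)) = fun r => r ^ 2 / 2 * k - r ^ 4 / 4 * l from funext h]
  refine ((((hasDerivAt_pow 2 s).div_const 2).mul_const k).sub
    (((hasDerivAt_pow 4 s).div_const 4).mul_const l)).congr_deriv ?_
  norm_num

theorem HasFiberingMap.hasDerivAt_zero_iff {X : Type*} [SMul ℝ X] {f : X → ℝ} {v : X} {k l : ℝ}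
    (h : HasFiberingMap f v k l) (hl : 0 < l) {t : ℝ} (ht : 0 < t) :
    HasDerivAt (fun r : ℝ => f (r • v)) 0 t ↔ t = √(k / l) :=
  calc HasDerivAt (fun r : ℝ => f (r • v)) 0 t ↔ t * k - t ^ 3 * l = 0 :=
        ⟨fun h0 => (h.hasDerivAt t).unique h0, fun h0 => h0 ▸ h.hasDerivAt t⟩
    _ ↔ t * (k - t ^ 2 * l) = 0 := by ring_nf
    _ ↔ k / l = t ^ 2 := by
        rw [mul_eq_zero_iff_left ht.ne', sub_eq_zero, div_eq_iff hl.ne']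
    _ ↔ t = √(k / l) := by
        rw [eq_comm (a := t), Real.sqrt_eq_iff_mul_self_eq_of_pos ht, eq_comm, pow_two]

variable {X : Type*} [NormedAddCommGroup X] [NormedSpace ℝ X] {f : X → ℝ} {v : X} {k l : ℝ}

theorem hasDerivAt_smul_const (s : ℝ) (v : X) : HasDerivAt (fun r : ℝ => r • v) v s := by
  simpa using (hasDerivAt_id s).smul_const v

theorem HasFiberingMap.fderiv_apply (h : HasFiberingMap f v k l) {s : ℝ}
    (hf : DifferentiableAt ℝ f (s • v)) : fderiv ℝ f (s • v) v = s * k - s ^ 3 * l :=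
  (hf.hasFDerivAt.comp_hasDerivAt s (hasDerivAt_smul_const s v)).unique (h.hasDerivAt s)

theorem HasFiberingMap.fderiv_apply_self (h : HasFiberingMap f v k l) (hf : ContDiff ℝ 1 f) :
    fderiv ℝ f v v = k - l := by
  simpa using h.fderiv_apply (s := 1) (hf.differentiable one_ne_zero _)

theorem HasFiberingMap.fderiv_fderiv_apply_self (h : HasFiberingMap f v k l) (hf : ContDiff ℝ 2 f) :
    fderiv ℝ (fderiv ℝ f) v v v = k - 3 * l := by
  have hdiff : DifferentiableAt ℝ (fderiv ℝ f) ((1 : ℝ) • v) :=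
    (hf.fderiv_right (m := 1) le_rfl).differentiable one_ne_zero _
  have hcomp := hdiff.hasFDerivAt.comp_hasDerivAt (1 : ℝ) (hasDerivAt_smul_const 1 v)
  have hleft : HasDerivAt (fun r : ℝ => fderiv ℝ f (r • v) v)
      (fderiv ℝ (fderiv ℝ f) ((1 : ℝ) • v) v v) 1 := by
    simpa using hcomp.clm_apply (hasDerivAt_const (1 : ℝ) v)
  have hright : HasDerivAt (fun r : ℝ => r * k - r ^ 3 * l) (k - 3 * l) 1 := by
    refine (((hasDerivAt_id (1 : ℝ)).mul_const k).sub
      ((hasDerivAt_pow 3 (1 : ℝ)).mul_const l)).congr_deriv ?_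
    norm_num
  simp only [h.fderiv_apply (hf.differentiable two_ne_zero _), one_smul] at hleft
  exact hleft.unique hright

end Fibering

/-! ### The functionals `K`, `I` and `E` -/

section Functionals

/-- A matrix whose quadratic form is positive at the nonzero vectors with nonnegative entries. -/
def IsStrictlyCopositive {n : Type*} [Fintype n] (g : Matrix n n ℝ) : Prop :=
  ∀ y : n → ℝ, (∀ i, 0 ≤ y i) → y ≠ 0 → 0 < ∑ i, ∑ j, g i j * y i * y j

theorem IsStrictlyCopositive.of_pos {n : Type*} [Fintype n] {g : Matrix n n ℝ}
    (hg : ∀ i j, 0 < g i j) : IsStrictlyCopositive g := by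
  intro y hy hy0
  obtain ⟨k, hk⟩ := Function.ne_iff.1 hy0
  have hnonneg (i j : n) : 0 ≤ g i j * y i * y j :=
    mul_nonneg (mul_nonneg (hg i j).le (hy i)) (hy j)
  have hkk : 0 < g k k * y k * y k :=
    mul_pos (mul_pos (hg k k) ((hy k).lt_of_ne' hk)) ((hy k).lt_of_ne' hk)
  exact Finset.sum_pos' (fun i _ => Finset.sum_nonneg fun j _ => hnonneg i j)
    ⟨k, Finset.mem_univ k, Finset.sum_pos' (fun j _ => hnonneg k j) ⟨k, Finset.mem_univ k, hkk⟩⟩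

theorem IsStrictlyCopositive.of_posDef {n : Type*} [Fintype n] {g : Matrix n n ℝ}
    (hg : g.PosDef) : IsStrictlyCopositive g := by
  intro y _ hy0
  have h := hg.dotProduct_mulVec_pos hy0
  simp only [dotProduct, Matrix.mulVec, star_trivial, Finset.mul_sum] at h
  simpa only [mul_left_comm (y _), mul_assoc] using h

theorem IsStrictlyCopositive.sum_nonneg {n : Type*} [Fintype n] {g : Matrix n n ℝ}
    (hg : IsStrictlyCopositive g) {y : n → ℝ} (hy : ∀ i, 0 ≤ y i) :
    0 ≤ ∑ i, ∑ j, g i j * y i * y j := by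
  obtain rfl | hy0 := eq_or_ne y 0
  · simp
  · exact (hg y hy hy0).le

theorem exists_mul_norm_sq_le_sum {ι V : Type*} [Fintype ι] [NormedAddCommGroup V]
    [NormedSpace ℝ V] {B : ι → V →L[ℝ] V →L[ℝ] ℝ} (hB : ∀ i, IsCoercive (B i)) :
    ∃ c : ℝ, 0 < c ∧
      ∀ u : PiLp 2 fun _ : ι => V, c * ‖u‖ ^ 2 ≤ ∑ i, B i (u i) (u i) := by
  choose b hb hbB using hB
  obtain ⟨c, hc, hcb⟩ : ∃ c : ℝ, 0 < c ∧ ∀ i, c ≤ b i :=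
    ((eventually_mem_nhdsWithin (a := (0 : ℝ)) (s := Set.Ioi 0)).and (eventually_all.2 fun i =>
      mem_nhdsWithin_of_mem_nhds (Iic_mem_nhds (hb i)))).exists
  refine ⟨c, hc, fun u => ?_⟩
  rw [PiLp.norm_sq_eq_of_L2, Finset.mul_sum]
  refine Finset.sum_le_sum fun i _ => (hbB i (u i)).trans' ?_
  rw [mul_assoc, ← pow_two]
  gcongr
  exact hcb i

theorem exists_sum_inner_le_mul_norm_pow_four {ι V W : Type*} [Fintype ι]
    [NormedAddCommGroup V] [NormedSpace ℝ V] [NormedAddCommGroup W] [InnerProductSpace ℝ W]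
    (P : V →L[ℝ] V →L[ℝ] W) (g : Matrix ι ι ℝ) :
    ∃ D : ℝ, 0 < D ∧ ∀ u : PiLp 2 fun _ : ι => V,
      ∑ i, ∑ j, g i j * inner ℝ (P (u i) (u i)) (P (u j) (u j)) ≤ D * ‖u‖ ^ 4 := by
  have hP (u : PiLp 2 fun _ : ι => V) (i : ι) : ‖P (u i) (u i)‖ ≤ ‖P‖ * ‖u‖ * ‖u‖ :=
    P.le_of_opNorm₂_le_of_le le_rfl (PiLp.norm_apply_le u i) (PiLp.norm_apply_le u i)
  have hterm (u : PiLp 2 fun _ : ι => V) (i j : ι) :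
      g i j * inner ℝ (P (u i) (u i)) (P (u j) (u j)) ≤ |g i j| * ‖P‖ ^ 2 * ‖u‖ ^ 4 :=
    calc g i j * inner ℝ (P (u i) (u i)) (P (u j) (u j))
        ≤ |g i j| * |inner ℝ (P (u i) (u i)) (P (u j) (u j))| :=
          (le_abs_self _).trans_eq (abs_mul _ _)
      _ ≤ |g i j| * (‖P (u i) (u i)‖ * ‖P (u j) (u j)‖) := by
          gcongr
          exact abs_real_inner_le_norm _ _
      _ ≤ |g i j| * (‖P‖ * ‖u‖ * ‖u‖ * (‖P‖ * ‖u‖ * ‖u‖)) := by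
          gcongr <;> exact hP u _
      _ = |g i j| * ‖P‖ ^ 2 * ‖u‖ ^ 4 := by ring
  refine ⟨∑ i, ∑ j, |g i j| * ‖P‖ ^ 2 + 1, by positivity, fun u => ?_⟩
  calc ∑ i, ∑ j, g i j * inner ℝ (P (u i) (u i)) (P (u j) (u j))
      ≤ ∑ i, ∑ j, |g i j| * ‖P‖ ^ 2 * ‖u‖ ^ 4 :=
        Finset.sum_le_sum fun i _ => Finset.sum_le_sum fun j _ => hterm u i j
    _ = (∑ i, ∑ j, |g i j| * ‖P‖ ^ 2) * ‖u‖ ^ 4 := by simp only [Finset.sum_mul]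
    _ ≤ (∑ i, ∑ j, |g i j| * ‖P‖ ^ 2 + 1) * ‖u‖ ^ 4 := by gcongr; linarith

theorem contDiff_sum_inner {ι V W : Type*} [Fintype ι] [NormedAddCommGroup V] [NormedSpace ℝ V]
    [NormedAddCommGroup W] [InnerProductSpace ℝ W] (P : V →L[ℝ] V →L[ℝ] W) (g : Matrix ι ι ℝ)
    {n : WithTop ℕ∞} : ContDiff ℝ n fun u : PiLp 2 fun _ : ι => V =>
      ∑ i, ∑ j, g i j * inner ℝ (P (u i) (u i)) (P (u j) (u j)) := by
  have hP (i : ι) : ContDiff ℝ n fun u : PiLp 2 fun _ : ι => V => P (u i) (u i) := by fun_prop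
  exact ContDiff.sum fun i _ => ContDiff.sum fun j _ =>
    contDiff_const.mul ((hP i).inner ℝ (hP j))

variable {N m : ℕ} {Ω : Set (Space N)} {ε : Fin m → ℝ} {a : Fin m → Space N → ℝ}
  {g : Matrix (Fin m) (Fin m) ℝ}

theorem sum_integral_eq_K (ε : Fin m → ℝ) (ha : ∀ i, MemLp (a i) ⊤ (vol Ω)) (u : H Ω m) :
    ∑ i, ∫ x in Ω, (ε i * ‖grad (u i) x‖ ^ 2 + a i x * fn (u i) x ^ 2) = K ε a u :=
  (integral_finsetSum _ fun i _ => integrable_schrodinger (ε i) (ha i) (u i)).symm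

theorem K_eq_sum (ε : Fin m → ℝ) (ha : ∀ i, MemLp (a i) ⊤ (vol Ω)) (u : H Ω m) :
    K ε a u = ∑ i, schrodingerForm (ε i) (ha i) (u i) (u i) := by
  simp only [schrodingerForm_eq_integral, sum_integral_eq_K ε ha]

theorem exists_mul_norm_sq_le_K (hN : 1 ≤ N) (hΩ : IsOpen Ω) (hΩb : Bornology.IsBounded Ω)
    (hε : ∀ i, 0 < ε i) (ha : ∀ i, MemLp (a i) ⊤ (vol Ω))
    (ha' : ∀ i, ∀ᵐ x ∂vol Ω, -(ε i * firstEigenvalue Ω) < a i x) :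
    ∃ c : ℝ, 0 < c ∧ ∀ u : H Ω m, c * ‖u‖ ^ 2 ≤ K ε a u := by
  simp only [K_eq_sum ε ha]
  exact exists_mul_norm_sq_le_sum fun i =>
    isCoercive_schrodingerForm hN hΩ hΩb (hε i) (ha i) (ha' i)

theorem K_pos (hN : 1 ≤ N) (hΩ : IsOpen Ω) (hΩb : Bornology.IsBounded Ω)
    (hε : ∀ i, 0 < ε i) (ha : ∀ i, MemLp (a i) ⊤ (vol Ω))
    (ha' : ∀ i, ∀ᵐ x ∂vol Ω, -(ε i * firstEigenvalue Ω) < a i x) {u : H Ω m} (hu : u ≠ 0) :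
    0 < K ε a u := by
  obtain ⟨c, hc, hcK⟩ := exists_mul_norm_sq_le_K hN hΩ hΩb hε ha ha'
  exact (mul_pos hc (pow_pos (norm_pos_iff.2 hu) 2)).trans_le (hcK u)

theorem hNorm_sq (hε : ∀ i, 0 ≤ ε i) (u : H Ω m) :
    hNorm ε u ^ 2 = ∑ i, ε i * ‖gradL2 Ω (u i)‖ ^ 2 := by
  rw [hNorm, Real.sq_sqrt (integral_nonneg fun x => Finset.sum_nonneg fun i _ =>
      mul_nonneg (hε i) (sq_nonneg _)),
    integral_finsetSum _ fun i _ => (integrable_norm_grad_sq (u i)).const_mul (ε i)]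
  simp only [integral_const_mul, integral_norm_grad_sq]

theorem exists_mul_norm_sq_le_hNorm_sq (hN : 1 ≤ N) (hΩb : Bornology.IsBounded Ω)
    (hε : ∀ i, 0 < ε i) : ∃ c : ℝ, 0 < c ∧ ∀ u : H Ω m, c * ‖u‖ ^ 2 ≤ hNorm ε u ^ 2 := by
  obtain ⟨b, hb, hbu⟩ := isCoercive_pullbackInner_gradL2 hN hΩb
  obtain ⟨c, hc, hcu⟩ := exists_mul_norm_sq_le_sum
    (B := fun i => ε i • pullbackInner (gradL2 Ω)) fun i =>
      ⟨ε i * b, mul_pos (hε i) hb, fun u => by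
        simpa only [smul_apply, smul_eq_mul, mul_assoc] using
          mul_le_mul_of_nonneg_left (hbu u) (hε i).le⟩
  refine ⟨c, hc, fun u => (hcu u).trans_eq ?_⟩
  simp only [hNorm_sq fun i => (hε i).le, smul_apply, smul_eq_mul, pullbackInner_apply_self]

theorem inner_mulH01_ae_eq (hS : HasSobolevL4 Ω) (c : ℝ) (u v : H01 Ω) :
    (fun x => c * inner ℝ (mulH01 hS u u x) (mulH01 hS v v x)) =ᵐ[vol Ω]
      fun x => c * fn u x ^ 2 * fn v x ^ 2 := by
  filter_upwards [coeFn_mulH01 hS u u, coeFn_mulH01 hS v v] with x hu hv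
  rw [hu, hv, RCLike.inner_apply, conj_trivial]
  ring

theorem integrable_quartic (hS : HasSobolevL4 Ω) (c : ℝ) (u v : H01 Ω) :
    Integrable (fun x => c * fn u x ^ 2 * fn v x ^ 2) (vol Ω) :=
  ((L2.integrable_inner _ _).const_mul c).congr (inner_mulH01_ae_eq hS c u v)

theorem integral_quartic (hS : HasSobolevL4 Ω) (c : ℝ) (u v : H01 Ω) :
    ∫ x in Ω, c * fn u x ^ 2 * fn v x ^ 2 =
      c * inner ℝ (mulH01 hS u u) (mulH01 hS v v) := by
  rw [L2.inner_def, ← integral_const_mul]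
  exact (integral_congr_ae (inner_mulH01_ae_eq hS c u v)).symm

theorem integrable_sum_quartic (hS : HasSobolevL4 Ω) (g : Matrix (Fin m) (Fin m) ℝ) (u : H Ω m)
    (i : Fin m) :
    Integrable (fun x => ∑ j, g i j * fn (u i) x ^ 2 * fn (u j) x ^ 2) (vol Ω) :=
  integrable_finsetSum _ fun j _ => integrable_quartic hS (g i j) (u i) (u j)

theorem sum_integral_eq_I (hS : HasSobolevL4 Ω) (g : Matrix (Fin m) (Fin m) ℝ) (u : H Ω m) :
    ∑ i, ∑ j, ∫ x in Ω, g i j * fn (u i) x ^ 2 * fn (u j) x ^ 2 = I g u := by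
  rw [I, integral_finsetSum _ fun i _ => integrable_sum_quartic hS g u i]
  exact Finset.sum_congr rfl fun i _ =>
    (integral_finsetSum _ fun j _ => integrable_quartic hS (g i j) (u i) (u j)).symm

theorem I_eq_sum (hS : HasSobolevL4 Ω) (g : Matrix (Fin m) (Fin m) ℝ) (u : H Ω m) :
    I g u = ∑ i, ∑ j, g i j * inner ℝ (mulH01 hS (u i) (u i)) (mulH01 hS (u j) (u j)) := by
  simp only [← integral_quartic, sum_integral_eq_I hS]

theorem I_pos (hS : HasSobolevL4 Ω) (hΩ : IsOpen Ω) (hΩb : Bornology.IsBounded Ω)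
    (hg : IsStrictlyCopositive g) {u : H Ω m} (hu : u ≠ 0) : 0 < I g u := by
  have hnonneg (x : Space N) : 0 ≤ ∑ i, ∑ j, g i j * fn (u i) x ^ 2 * fn (u j) x ^ 2 :=
    hg.sum_nonneg fun i => sq_nonneg (fn (u i) x)
  refine (integral_nonneg hnonneg).lt_of_ne' fun h0 => hu (PiLp.ext fun i =>
    (map_eq_zero_iff _ (toL2_injective hΩ hΩb)).1 ((Lp.eq_zero_iff_ae_eq_zero).2 ?_))
  filter_upwards [(integral_eq_zero_iff_of_nonneg hnonneg
    (integrable_finsetSum _ fun i _ => integrable_sum_quartic hS g u i)).1 h0] with x hx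
  have hsq : (fun i => fn (u i) x ^ 2) = 0 := by
    by_contra hne
    exact (hg _ (fun i => sq_nonneg _) hne).ne' hx
  exact pow_eq_zero_iff two_ne_zero |>.1 (congrFun hsq i)

theorem exists_I_le_mul_norm_pow_four (hS : HasSobolevL4 Ω) (g : Matrix (Fin m) (Fin m) ℝ) :
    ∃ D : ℝ, 0 < D ∧ ∀ u : H Ω m, I g u ≤ D * ‖u‖ ^ 4 := by
  simp only [I_eq_sum hS]
  exact exists_sum_inner_le_mul_norm_pow_four (mulH01 hS) g

theorem contDiff_K (ε : Fin m → ℝ) (ha : ∀ i, MemLp (a i) ⊤ (vol Ω)) {n : WithTop ℕ∞} :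
    ContDiff ℝ n (K ε a : H Ω m → ℝ) := by
  rw [funext (K_eq_sum ε ha)]
  fun_prop

theorem contDiff_I (hS : HasSobolevL4 Ω) (g : Matrix (Fin m) (Fin m) ℝ) {n : WithTop ℕ∞} :
    ContDiff ℝ n (I g : H Ω m → ℝ) := by
  rw [funext (I_eq_sum hS g)]
  exact contDiff_sum_inner (mulH01 hS) g

theorem contDiff_E (hS : HasSobolevL4 Ω) (ha : ∀ i, MemLp (a i) ⊤ (vol Ω)) {n : WithTop ℕ∞} :
    ContDiff ℝ n (E ε a g : H Ω m → ℝ) :=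
  (contDiff_const.mul (contDiff_K ε ha)).sub (contDiff_const.mul (contDiff_I hS g))

theorem fn_smul_ae_eq (s : ℝ) (u : H01 Ω) : fn (s • u) =ᵐ[vol Ω] s • fn u :=
  Lp.coeFn_smul s (toL2 Ω u)

theorem grad_smul_ae_eq (s : ℝ) (u : H01 Ω) : grad (s • u) =ᵐ[vol Ω] s • grad u :=
  Lp.coeFn_smul s (gradL2 Ω u)

theorem K_smul (ε : Fin m → ℝ) (a : Fin m → Space N → ℝ) (s : ℝ) (v : H Ω m) :
    K ε a (s • v) = s ^ 2 * K ε a v := by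
  rw [K, K, ← integral_const_mul]
  refine integral_congr_ae ?_
  filter_upwards [eventually_all.2 fun i => fn_smul_ae_eq s (v i),
    eventually_all.2 fun i => grad_smul_ae_eq s (v i)] with x hfn hgrad
  simp only [PiLp.smul_apply, hfn, hgrad, Pi.smul_apply, norm_smul, mul_pow, Real.norm_eq_abs,
    sq_abs, smul_eq_mul, Finset.mul_sum]
  exact Finset.sum_congr rfl fun i _ => by ring

theorem I_smul (g : Matrix (Fin m) (Fin m) ℝ) (s : ℝ) (v : H Ω m) :
    I g (s • v) = s ^ 4 * I g v := by
  rw [I, I, ← integral_const_mul]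
  refine integral_congr_ae ?_
  filter_upwards [eventually_all.2 fun i => fn_smul_ae_eq s (v i)] with x hfn
  simp only [PiLp.smul_apply, hfn, Pi.smul_apply, smul_eq_mul, mul_pow, Finset.mul_sum]
  exact Finset.sum_congr rfl fun i _ => Finset.sum_congr rfl fun j _ => by ring

theorem hasFiberingMap_E (ε : Fin m → ℝ) (a : Fin m → Space N → ℝ)
    (g : Matrix (Fin m) (Fin m) ℝ) (v : H Ω m) :
    HasFiberingMap (E ε a g) v (K ε a v) (I g v) := by
  intro s
  rw [E, K_smul, I_smul]
  ring

theorem mem_nehari_iff (hS : HasSobolevL4 Ω) (ha : ∀ i, MemLp (a i) ⊤ (vol Ω)) {u : H Ω m} :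
    u ∈ nehari Ω ε a g ↔ u ≠ 0 ∧ K ε a u = I g u := by
  have h : fderiv ℝ (E ε a g) u u = K ε a u - I g u :=
    HasFiberingMap.fderiv_apply_self (X := H Ω m) (hasFiberingMap_E ε a g u) (contDiff_E hS ha)
  rw [← sub_eq_zero (b := I g u), ← h]
  rfl

theorem fderiv_fderiv_E_apply_self (hS : HasSobolevL4 Ω) (ha : ∀ i, MemLp (a i) ⊤ (vol Ω))
    (u : H Ω m) : fderiv ℝ (fderiv ℝ (E ε a g)) u u u = K ε a u - 3 * I g u :=
  HasFiberingMap.fderiv_fderiv_apply_self (X := H Ω m) (hasFiberingMap_E ε a g u)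
    (contDiff_E hS ha)

theorem sqrt_smul_mem_nehari (hS : HasSobolevL4 Ω) (ha : ∀ i, MemLp (a i) ⊤ (vol Ω)) {v : H Ω m}
    (hv : v ≠ 0) (hK : 0 < K ε a v) (hI : 0 < I g v) :
    √(K ε a v / I g v) • v ∈ nehari Ω ε a g := by
  refine (mem_nehari_iff hS ha).2 ⟨fun h0 => hv
    ((IsUnit.mk0 _ (Real.sqrt_pos.2 (div_pos hK hI)).ne').smul_eq_zero.1 h0), ?_⟩
  rw [K_smul, I_smul, show 4 = 2 * 2 from rfl, pow_mul, Real.sq_sqrt (div_pos hK hI).le]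
  field_simp

theorem exists_le_hNorm_of_mem_nehari (hN : 1 ≤ N) (hS : HasSobolevL4 Ω) (hΩ : IsOpen Ω)
    (hΩb : Bornology.IsBounded Ω) (hε : ∀ i, 0 < ε i) (ha : ∀ i, MemLp (a i) ⊤ (vol Ω))
    (ha' : ∀ i, ∀ᵐ x ∂vol Ω, -(ε i * firstEigenvalue Ω) < a i x) :
    ∃ σ : ℝ, 0 < σ ∧ ∀ u ∈ nehari Ω ε a g, σ ≤ hNorm ε u := by
  obtain ⟨c, hc, hcK⟩ := exists_mul_norm_sq_le_K hN hΩ hΩb hε ha ha'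
  obtain ⟨D, hD, hID⟩ := exists_I_le_mul_norm_pow_four hS g
  obtain ⟨b, hb, hbu⟩ := exists_mul_norm_sq_le_hNorm_sq (m := m) hN hΩb hε
  refine ⟨√(b * (c / D)), by positivity, fun u hu =>
    Real.sqrt_le_iff.2 ⟨Real.sqrt_nonneg _, ?_⟩⟩
  obtain ⟨hu0, hKI⟩ := (mem_nehari_iff hS ha).1 hu
  have hnorm : c / D ≤ ‖u‖ ^ 2 := by
    rw [div_le_iff₀ hD]
    refine le_of_mul_le_mul_right ?_ (pow_pos (norm_pos_iff.2 hu0) 2)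
    calc c * ‖u‖ ^ 2 ≤ K ε a u := hcK u
      _ = I g u := hKI
      _ ≤ D * ‖u‖ ^ 4 := hID u
      _ = ‖u‖ ^ 2 * D * ‖u‖ ^ 2 := by ring
  calc b * (c / D) ≤ b * ‖u‖ ^ 2 := by gcongr
    _ ≤ hNorm ε u ^ 2 := hbu u

end Functionals

end NehariSystem

end

theorem lemma2p1_general {N m : ℕ} (hN : 1 ≤ N) (hN' : N ≤ 4)
    (Ω : Set (NehariSystem.Space N)) (hΩ : IsOpen Ω) (hΩb : Bornology.IsBounded Ω)
    (ε : Fin m → ℝ) (hε : ∀ i, 0 < ε i)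
    (g : Matrix (Fin m) (Fin m) ℝ) (hg : NehariSystem.IsStrictlyCopositive g)
    (a : Fin m → NehariSystem.Space N → ℝ)
    (ha : ∀ i, MemLp (a i) ⊤ (volume.restrict Ω))
    (ha' : ∀ i, ∀ᵐ x ∂(volume.restrict Ω), -(ε i * NehariSystem.firstEigenvalue Ω) < a i x) :
    ContDiff ℝ 2 (NehariSystem.E ε a g : NehariSystem.H Ω m → ℝ) ∧
    (∀ v : NehariSystem.H Ω m, v ≠ 0 → ∃ s : ℝ, 0 < s ∧
      (∀ t : ℝ, 0 < t →
        (HasDerivAt (fun r : ℝ => NehariSystem.E ε a g (r • v)) 0 t ↔ t = s)) ∧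
      s • v ∈ NehariSystem.nehari Ω ε a g ∧
      s = Real.sqrt (NehariSystem.K ε a v / NehariSystem.I g v) ∧
      s = Real.sqrt
        ((∑ i, ∫ x in Ω, (ε i * ‖NehariSystem.grad (v i) x‖ ^ 2 +
            a i x * NehariSystem.fn (v i) x ^ 2)) /
          (∑ i, ∑ j, ∫ x in Ω,
            g i j * NehariSystem.fn (v i) x ^ 2 * NehariSystem.fn (v j) x ^ 2))) ∧
    (∀ u ∈ NehariSystem.nehari Ω ε a g,
      fderiv ℝ (fderiv ℝ (NehariSystem.E ε a g)) u u u < 0) ∧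
    (∃ σ₀ : ℝ, 0 < σ₀ ∧ ∀ u ∈ NehariSystem.nehari Ω ε a g, σ₀ ≤ NehariSystem.hNorm ε u) := by
  have hS := NehariSystem.hasSobolevL4 hN hN' hΩb
  refine ⟨NehariSystem.contDiff_E hS ha, fun v hv => ?_, fun u hu => ?_,
    NehariSystem.exists_le_hNorm_of_mem_nehari hN hS hΩ hΩb hε ha ha'⟩
  · have hK := NehariSystem.K_pos hN hΩ hΩb hε ha ha' hv
    have hI := NehariSystem.I_pos hS hΩ hΩb hg hv
    exact ⟨_, Real.sqrt_pos.2 (div_pos hK hI),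
      fun t ht => (NehariSystem.hasFiberingMap_E ε a g v).hasDerivAt_zero_iff hI ht,
      NehariSystem.sqrt_smul_mem_nehari hS ha hv hK hI, rfl,
      by rw [NehariSystem.sum_integral_eq_K ε ha, NehariSystem.sum_integral_eq_I hS]⟩
  · obtain ⟨hu0, hKI⟩ := (NehariSystem.mem_nehari_iff hS ha).1 hu
    have hK := NehariSystem.K_pos hN hΩ hΩb hε ha ha' hu0
    rw [NehariSystem.fderiv_fderiv_E_apply_self hS ha]
    linarith

theorem lemma2p1 {N m : ℕ} (hN : 1 ≤ N) (hN' : N ≤ 4)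
    (Ω : Set (NehariSystem.Space N)) (hΩ : IsOpen Ω) (hΩb : Bornology.IsBounded Ω)
    (ε : Fin m → ℝ) (hε : ∀ i, 0 < ε i)
    (g : Matrix (Fin m) (Fin m) ℝ) (hg : g.IsSymm)
    (hg' : (∀ i j, 0 < g i j) ∨ g.PosDef)
    (a : Fin m → NehariSystem.Space N → ℝ)
    (ha : ∀ i, MemLp (a i) ⊤ (volume.restrict Ω))
    (ha' : ∀ i, ∀ᵐ x ∂(volume.restrict Ω), -(ε i * NehariSystem.firstEigenvalue Ω) < a i x) :
    -- the derivatives below exist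
    ContDiff ℝ 2 (NehariSystem.E ε a g : NehariSystem.H Ω m → ℝ) ∧
    -- (i)
    (∀ v : NehariSystem.H Ω m, v ≠ 0 → ∃ s : ℝ, 0 < s ∧
      (∀ t : ℝ, 0 < t →
        (HasDerivAt (fun r : ℝ => NehariSystem.E ε a g (r • v)) 0 t ↔ t = s)) ∧
      s • v ∈ NehariSystem.nehari Ω ε a g ∧
      s = Real.sqrt (NehariSystem.K ε a v / NehariSystem.I g v) ∧
      s = Real.sqrt
        ((∑ i, ∫ x in Ω, (ε i * ‖NehariSystem.grad (v i) x‖ ^ 2 +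
            a i x * NehariSystem.fn (v i) x ^ 2)) /
          (∑ i, ∑ j, ∫ x in Ω,
            g i j * NehariSystem.fn (v i) x ^ 2 * NehariSystem.fn (v j) x ^ 2))) ∧
    -- (ii)
    (∀ u ∈ NehariSystem.nehari Ω ε a g,
      fderiv ℝ (fderiv ℝ (NehariSystem.E ε a g)) u u u < 0) ∧
    -- (iii)
    (∃ σ₀ : ℝ, 0 < σ₀ ∧ ∀ u ∈ NehariSystem.nehari Ω ε a g, σ₀ ≤ NehariSystem.hNorm ε u) :=
  lemma2p1_general hN hN' Ω hΩ hΩb ε hε g (hg'.elim .of_pos .of_posDef) a ha ha'
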